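/- Let $N,m$ be natural numbers. For $1\le j\le N$ let $\zeta_j=\xi_j+\mathrm i\eta_j$ with $\xi_j\in\mathbb R$, $\eta_j>0$, let $\alpha_j\in\mathbb R$, and let $u_j\in\mathbb C^m$ be a (row) unit vector; write $u_j\cdot u_k^\dagger=\sum_a u_j^{(a)}\overline{u_k^{(a)}}$. Put $$\tau_j=2\eta_j(x+4\xi_jt),\qquad \Theta_j=2\xi_jx+4(\xi_j^2-\eta_j^2)t,\qquad \lambda_{jkl}=-\frac{2\eta_l\,(u_j\cdot u_l^\dagger)}{(\zeta_l-\zeta_k^*)(\zeta_l-\zeta_j^*)},$$ $$U_{jk}=\frac{e^{\tau_j+\alpha_j}}{2\eta_j}\delta_{jk}+\sum_{l=1}^N\lambda_{jkl}\,e^{-(\tau_l+\alpha_l)+\mathrm i(\Theta_l-\Theta_j)},\qquad q(x,t)=2\sum_{j,k=1}^N(U^{-1})_{jk}\,e^{-\mathrm i\Theta_k}u_k ,$$ the $N$-soliton solution of the Manakov model $\mathrm i q_t+q_{xx}+2\|q\|^2q=0$. Put also $$c_{jk}=\frac{\mathrm i}{\zeta_k-\zeta_j^*},\qquad d_{jk}=\frac{\mathrm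 i\,(u_j\cdot u_k^\dagger)}{\zeta_k-\zeta_j^*}.$$ Assume $\xi_1>\xi_2>\dots>\xi_N$. Then $U(x,t)$ is invertible for all real $x,t$, and the following hold. (a) For distinct indices $i_1,\dots,i_p\in\{1,\dots,N\}$ $(p\ge 0)$ the matrices $(d_{i_ai_b})_{a,b}$ and $(c_{i_ai_b})_{a,b}$ are Hermitian and positive definite, and there is a (unique) real number $\varphi_{i_1\cdots i_p}$ with $$e^{-2\varphi_{i_1\cdots i_p}}=\frac1{\lambda_{i_1i_1i_1}\cdots\lambda_{i_pi_pi_p}}\sum_{\{l_1,\dots,l_p\}=\{i_1,\dots,i_p\}}\det\bigl(\lambda_{i_ai_bl_a}\bigr)_{a,b=1}^p .$$ (b) For distinct indices $i_1,\dots,i_n$ $(n\ge1)$ define $\varphi_{\{i_1,\dots,i_{n-1}\},i_n}=\varphi_{i_1\cdots i_n}-\varphi_{i_1\cdots i_{n-1}}$ and $$u_{\{i_1,\dots,i_{n-1}\},i_n}=\frac{e^{\varphi_{i_1\cdots i_n}+\varphi_{i_1\cdots i_{n-1}}}}{\lambda_{i_1i_1i_1}\cdots\lambda_{i_{n-1}i_{n-1}i_{n-1}}}\sum_{j=1}^n\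 \sum_{\{l_1,\dots,l_{n-1}\}=\{i_1,\dots,i_{n-1}\}}\det M^{(j,l)}\;u_{i_j},$$ where the $n\times n$ matrix $M^{(j,l)}$ has $j$-th row $(1,\dots,1)$ and its other rows, from top to bottom, are $(\lambda_{i_ri_bl_a})_{b=1}^n$ for $a=1,\dots,n-1$, $r$ being the $a$-th element of $\{1,\dots,n\}\setminus\{j\}$. Then $$e^{-2\varphi_{\{i_1,\dots,i_{n-1}\},i_n}}=\prod_{l=1}^{n-1}\left|\frac{\zeta_{i_l}-\zeta_{i_n}}{\zeta_{i_l}-\zeta_{i_n}^*}\right|^2\cdot\frac{\det(d_{i_ai_b})_{a,b=1}^{n}}{d_{i_ni_n}\,\det(d_{i_ai_b})_{a,b=1}^{n-1}}\ (>0),$$ $$u_{\{i_1,\dots,i_{n-1}\},i_n}=e^{\varphi_{\{i_1,\dots,i_{n-1}\},i_n}}\prod_{l=1}^{n-1}\frac{\zeta_{i_l}^*-\zeta_{i_n}^*}{\zeta_{i_l}-\zeta_{i_n}^*}\cdot\frac{\begin{vmatrix}d_{i_1i_1}&\cdots&d_{i_1i_{n-1}}&u_{i_1}\\ \vdots&&\vdots&\vdots\\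 d_{i_ni_1}&\cdots&d_{i_ni_{n-1}}&u_{i_n}\end{vmatrix}}{\det(d_{i_ai_b})_{a,b=1}^{n-1}},$$ where the determinant with vectors in its last column is the vector given by Laplace expansion along that column. Both quantities are unchanged under permutations of $i_1,\dots,i_{n-1}$, and $\varphi_{\{\,\},i}=0$, $u_{\{\,\},i}=u_i$. (c) Uniformly in $x\in\mathbb R$, $$q(x,t)-\sum_{n=1}^N2\eta_n\,\mathrm{sech}\bigl(\tau_n+\alpha_n+\varphi_{\{1,\dots,n-1\},n}\bigr)e^{-\mathrm i\Theta_n}u_{\{1,\dots,n-1\},n}\longrightarrow0\qquad(t\to-\infty),$$ $$q(x,t)-\sum_{n=1}^N2\eta_n\,\mathrm{sech}\bigl(\tau_n+\alpha_n+\varphi_{\{n+1,\dots,N\},n}\bigr)e^{-\mathrm i\Theta_n}u_{\{n+1,\dots,N\},n}\longrightarrow0\qquad(t\to+\infty).$$ -/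

import Mathlib

open scoped ComplexConjugate ComplexOrder

noncomputable section

namespace Manakov

/-- The hyperbolic secant. -/
def sech (y : ℝ) : ℝ := (Real.cosh y)⁻¹

/-- The vector-valued determinant `| A v |` of an array whose last column consists of vectors,
defined by the Laplace expansion with respect to that last column. -/
def vecDet {E : Type*} [AddCommGroup E] [Module ℂ E] {p : ℕ}
    (A : Matrix (Fin (p + 1)) (Fin p) ℂ) (v : Fin (p + 1) → E) : E :=
  ∑ j : Fin (p + 1), ((-1) ^ ((j : ℕ) + p) * (A.submatrix j.succAbove id).det) • v j

/-- The parameters of an `N`-soliton solution with `m` components: `ζ_j = ξ_j + i η_j` with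
`η_j > 0`, real positions `α_j`, and unit polarization vectors `u_j`. -/
structure SolitonData (N m : ℕ) where
  ξ : Fin N → ℝ
  η : Fin N → ℝ
  α : Fin N → ℝ
  u : Fin N → EuclideanSpace ℂ (Fin m)
  η_pos : ∀ j, 0 < η j
  norm_u : ∀ j, ‖u j‖ = 1

namespace SolitonData

variable {N m : ℕ} (D : SolitonData N m)

/-- `ζ_j = ξ_j + i η_j`. -/
def ζ (j : Fin N) : ℂ := (D.ξ j : ℂ) + Complex.I * (D.η j : ℂ)

/-- `τ_j = 2 η_j (x + 4 ξ_j t)`. -/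
def τ (j : Fin N) (x t : ℝ) : ℝ := 2 * D.η j * (x + 4 * D.ξ j * t)

/-- `Θ_j = 2 ξ_j x + 4 (ξ_j² - η_j²) t`. -/
def Θ (j : Fin N) (x t : ℝ) : ℝ := 2 * D.ξ j * x + 4 * (D.ξ j ^ 2 - D.η j ^ 2) * t

/-- The Hermitian product `u_j · u_k† = ∑ a, u_j^(a) (u_k^(a))^*` of row vectors (Mathlib's inner
product is conjugate-linear in its first argument). -/
def herm (j k : Fin N) : ℂ := inner ℂ (D.u k) (D.u j)

/-- `λ_{jkl} = - 2 η_l (u_j · u_l†) / ((ζ_l - ζ_k^*) (ζ_l - ζ_j^*))`. -/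
def lam (j k l : Fin N) : ℂ :=
  -(2 * (D.η l : ℂ) * D.herm j l) / ((D.ζ l - conj (D.ζ k)) * (D.ζ l - conj (D.ζ j)))

/-- The matrix `U` of the `N`-soliton formula. -/
def U (x t : ℝ) : Matrix (Fin N) (Fin N) ℂ := Matrix.of fun j k =>
  (if j = k then Complex.exp ((D.τ j x t + D.α j : ℝ) : ℂ) / (2 * (D.η j : ℂ)) else 0) +
    ∑ l, D.lam j k l * Complex.exp (-((D.τ l x t + D.α l : ℝ) : ℂ) +
      Complex.I * ((D.Θ l x t - D.Θ j x t : ℝ) : ℂ))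

/-- The `N`-soliton solution `q = 2 ∑_{j,k} (U⁻¹)_{jk} e^{-iΘ_k} u_k`. -/
def q (x t : ℝ) : EuclideanSpace ℂ (Fin m) :=
  (2 : ℂ) • ∑ j, ∑ k,
    ((D.U x t)⁻¹ j k * Complex.exp (-Complex.I * (D.Θ k x t : ℂ))) • D.u k

/-- `c_{jk} = i / (ζ_k - ζ_j^*)`. -/
def c (j k : Fin N) : ℂ := Complex.I / (D.ζ k - conj (D.ζ j))

/-- `d_{jk} = i (u_j · u_k†) / (ζ_k - ζ_j^*)`. -/
def d (j k : Fin N) : ℂ := Complex.I * D.herm j k / (D.ζ k - conj (D.ζ j))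

/-- The matrix `(c_{i_a i_b})`. -/
def cMat {p : ℕ} (i : Fin p → Fin N) : Matrix (Fin p) (Fin p) ℂ :=
  Matrix.of fun a b => D.c (i a) (i b)

/-- The matrix `(d_{i_a i_b})`. -/
def dMat {p : ℕ} (i : Fin p → Fin N) : Matrix (Fin p) (Fin p) ℂ :=
  Matrix.of fun a b => D.d (i a) (i b)

/-- The right-hand side of the definition of `e^{-2 φ_{i_1 … i_p}}`: the sum over all
arrangements `(l_1, …, l_p)` of `{i_1, …, i_p}` of the determinants `|λ_{i_a i_b l_a}|`, divided
by `λ_{i_1 i_1 i_1} ⋯ λ_{i_p i_p i_p}`. -/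
def phiSum {p : ℕ} (i : Fin p → Fin N) : ℂ :=
  (∏ a, D.lam (i a) (i a) (i a))⁻¹ *
    ∑ σ : Equiv.Perm (Fin p), (Matrix.of fun a b => D.lam (i a) (i b) (i (σ a))).det

/-- The real number `φ_{i_1 … i_p}` with `e^{-2 φ} = phiSum i`. That `phiSum i` is real and
positive, so that this equation does hold, is part of the theorem. -/
def phi {p : ℕ} (i : Fin p → Fin N) : ℝ := -(Real.log (D.phiSum i).re) / 2

/-- `φ_{{i_1, …, i_p}, i_{p+1}} = φ_{i_1 … i_p i_{p+1}} - φ_{i_1 … i_p}`. -/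
def phaseShift {p : ℕ} (i : Fin (p + 1) → Fin N) : ℝ := D.phi i - D.phi (Fin.init i)

/-- `u_{{i_1, …, i_p}, i_{p+1}}`. In the `j`-th determinant the `j`-th row is `(1, …, 1)`, and the
remaining rows are, in order, `(λ_{i_r i_b l_a})_b` with `a = 1, …, p` and `r` running through the
indices other than `j`. -/
def polarization {p : ℕ} (i : Fin (p + 1) → Fin N) : EuclideanSpace ℂ (Fin m) :=
  (Complex.exp ((D.phi i + D.phi (Fin.init i) : ℝ) : ℂ) *
      (∏ a : Fin p, D.lam (i a.castSucc) (i a.castSucc) (i a.castSucc))⁻¹) •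
    ∑ j : Fin (p + 1), ∑ σ : Equiv.Perm (Fin p),
      (Matrix.of (j.insertNth (α := fun _ => Fin (p + 1) → ℂ) (fun _ => 1)
        (fun a b => D.lam (i (j.succAbove a)) (i b) (i (σ a).castSucc)))).det • D.u (i j)

/-- The right-hand side `∏ |(ζ_{i_l} - ζ_{i_n}) / (ζ_{i_l} - ζ_{i_n}^*)|² ⬝ |d_{i_1 i_1} ⋯ d_{i_n i_n}| /
(d_{i_n i_n} |d_{i_1 i_1} ⋯ d_{i_{n-1} i_{n-1}}|)` of the determinant formula for the phase
shift. -/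
def phaseShiftFormula {p : ℕ} (i : Fin (p + 1) → Fin N) : ℂ :=
  (∏ l : Fin p, ((‖(D.ζ (i l.castSucc) - D.ζ (i (Fin.last p))) /
      (D.ζ (i l.castSucc) - conj (D.ζ (i (Fin.last p))))‖ ^ 2 : ℝ) : ℂ)) *
    ((D.dMat i).det / (D.d (i (Fin.last p)) (i (Fin.last p)) * (D.dMat (Fin.init i)).det))

/-- The right-hand side of the determinant formula for the polarization, with the vector-valued
determinant whose last column is `u_{i_1}, …, u_{i_n}`. -/
def polarizationFormula {p : ℕ} (i : Fin (p + 1) → Fin N) : EuclideanSpace ℂ (Fin m) :=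
  (Complex.exp (D.phaseShift i : ℂ) *
      (∏ l : Fin p, (conj (D.ζ (i l.castSucc)) - conj (D.ζ (i (Fin.last p)))) /
        (D.ζ (i l.castSucc) - conj (D.ζ (i (Fin.last p))))) /
      (D.dMat (Fin.init i)).det) •
    vecDet (Matrix.of fun r (b : Fin p) => D.d (i r) (i b.castSucc)) (fun r => D.u (i r))

/-- The sequence consisting of the elements of `S` in increasing order, followed by `n`. -/
def withLast (S : Finset (Fin N)) (n : Fin N) : Fin (S.card + 1) → Fin N :=
  Fin.snoc (α := fun _ => Fin N) (S.orderEmbOfFin rfl) n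

/-- The single soliton
`q_{S,n} = 2 η_n sech (τ_n + α_n + φ_{S,n}) e^{-iΘ_n} u_{S,n}`. -/
def soliton (S : Finset (Fin N)) (n : Fin N) (x t : ℝ) : EuclideanSpace ℂ (Fin m) :=
  (((2 * D.η n * sech (D.τ n x t + D.α n + D.phaseShift (withLast S n)) : ℝ) : ℂ) *
      Complex.exp (-Complex.I * (D.Θ n x t : ℂ))) • D.polarization (withLast S n)

end SolitonData

end Manakov

end

/-! The factorization `λ_{jkl} = 2 η_l d_{jl} c_{kl}` underlies everything. Here `c` is a Cauchy
matrix and also the Gram matrix of the functions `e^{iζ_k s}` on `(0, ∞)`, and `d` is its Hadamard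
product with the Gram matrix of the `u_j`. Both are positive definite because the `ξ_j`, hence the
`ζ_j`, are distinct.

Determinant formulas: summed over arrangements, the determinants of `λ` split into a minor of `c`
times a minor of `d` (`sum_perm_det_eq`). The `c` part is evaluated in closed form by rational
interpolation (`sum_mul_prod_erase_eq`), which yields the products of differences of the `ζ`; the
`d` part stays as it is.

Asymptotics: put `z_j = e^{τ_j + α_j + iΘ_j} / (2 η_j)` and write `z_j = b_j / a_j`. Up to
invertible factors `U` is `B C B^* + A d A^*` with `C` the inverse transpose of `c`. This is
positive definite whenever no pair `(a_j, b_j)` vanishes, so `q` extends continuously to the points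
where some `z_j` are `0` or `∞`. With the normalization `|a_j| + |b_j| = 1` the parameter space is
compact. As `t → ±∞` the products `a_n b_j` with `j` in `S n`, and `a_j b_n` with `j` in neither `S
n` nor `{n}`, tend to `0` uniformly in `x`. Hence at a limit point at most one `z_n` is neither `0`
nor `∞`, and there the extended solution is exactly one soliton, or zero (`homSol_eq_sum`).
Convergence along every ultrafilter gives the claim, with no division of the line into regions. -/

open scoped ComplexConjugate ComplexOrder

noncomputable section

namespace Manakov

open scoped Matrix

/-! ### Rational interpolation for Cauchy systems -/

section Cauchy

open Polynomial

variable {ι K : Type*} [Fintype ι] [DecidableEq ι] [Field K]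

/-- A rational function `∑ y k / (x - w k)` that vanishes at all `z j` with `j ≠ n` is, up to the
factor `∑ y k`, equal to `∏_{j ≠ n} (x - z j) / ∏ (x - w k)`. -/
theorem sum_mul_prod_erase_eq {z w y : ι → K} (n : ι) (hz : Function.Injective z)
    (hzw : ∀ j k, z j ≠ w k) (hy : ∀ j, j ≠ n → ∑ k, y k / (z j - w k) = 0) (x : K) :
    ∑ k, y k * ∏ l ∈ Finset.univ.erase k, (x - w l) =
      (∑ k, y k) * ∏ l ∈ Finset.univ.erase n, (x - z l) := by
  have key : ∑ k, C (y k) *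
      (Lagrange.nodal (Finset.univ.erase k) w - Lagrange.nodal (Finset.univ.erase n) z) = 0 := by
    refine eq_zero_of_degree_lt_of_eval_index_eq_zero (Finset.univ.erase n) (v := z)
      hz.injOn ?_ ?_
    -- Both nodal polynomials are monic of degree `card ι - 1`, so each difference drops in degree
    -- and is determined by the `card ι - 1` nodes `z j`, `j ≠ n`.
    · refine (degree_sum_le _ _).trans_lt ((Finset.sup_lt_iff (WithBot.bot_lt_coe _)).2 ?_)
      intro k _
      rw [← smul_eq_C_mul]
      refine (degree_smul_le _ _).trans_lt ?_
      have hc : (Finset.univ.erase k).card = (Finset.univ.erase n).card := by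
        simp [Finset.card_erase_of_mem]
      have := degree_sub_lt_left (p := Lagrange.nodal (Finset.univ.erase k) w)
        (q := Lagrange.nodal (Finset.univ.erase n) z)
        (by simp only [Lagrange.degree_nodal, hc]) Lagrange.nodal_ne_zero
        (by rw [Lagrange.nodal_monic, Lagrange.nodal_monic])
      rwa [Lagrange.degree_nodal, hc] at this
    · intro j hj
      have hjn := Finset.ne_of_mem_erase hj
      have h0 : ∏ l ∈ Finset.univ.erase n, (z j - z l) = 0 :=
        Finset.prod_eq_zero hj (sub_self _)
      simp only [eval_finsetSum, eval_mul, eval_C, eval_sub, Lagrange.eval_nodal, h0, sub_zero]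
      have h1 : ∀ k, y k * ∏ l ∈ Finset.univ.erase k, (z j - w l) =
          y k / (z j - w k) * ∏ l, (z j - w l) := by
        intro k
        rw [← Finset.mul_prod_erase _ _ (Finset.mem_univ k)]
        have := sub_ne_zero.2 (hzw j k)
        field_simp
      simp_rw [h1, ← Finset.sum_mul, hy j hjn, zero_mul]
  have := congrArg (eval x) key
  simp only [eval_finsetSum, eval_mul, eval_C, eval_sub, Lagrange.eval_nodal, eval_zero, mul_sub,
    Finset.sum_sub_distrib, ← Finset.sum_mul] at this
  exact sub_eq_zero.1 this

/-- The interpolation identity at `x = z n`; it determines `∑ y k` from the one nonzero right-hand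
side. -/
theorem sum_mul_prod_eq_of_cauchy {z w y : ι → K} {t : K} (n : ι) (hz : Function.Injective z)
    (hzw : ∀ j k, z j ≠ w k) (hy : ∀ j, j ≠ n → ∑ k, y k / (z j - w k) = 0)
    (hn : ∑ k, y k / (z n - w k) = t) :
    (∑ k, y k) * ∏ l ∈ Finset.univ.erase n, (z n - z l) = t * ∏ l, (z n - w l) := by
  rw [← sum_mul_prod_erase_eq n hz hzw hy, ← hn, Finset.sum_mul]
  refine Finset.sum_congr rfl fun k _ => ?_
  rw [← Finset.mul_prod_erase _ _ (Finset.mem_univ k)]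
  have := sub_ne_zero.2 (hzw n k)
  field_simp

/-- The interpolation identity at `x = w n`, where only the term `k = n` survives. -/
theorem apply_mul_prod_eq_of_cauchy {z w y : ι → K} (n : ι) (hz : Function.Injective z)
    (hzw : ∀ j k, z j ≠ w k) (hy : ∀ j, j ≠ n → ∑ k, y k / (z j - w k) = 0) :
    y n * ∏ l ∈ Finset.univ.erase n, (w n - w l) =
      (∑ k, y k) * ∏ l ∈ Finset.univ.erase n, (w n - z l) := by
  rw [← sum_mul_prod_erase_eq n hz hzw hy]
  symm
  refine Finset.sum_eq_single n (fun k _ hk => ?_) (by simp)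
  rw [Finset.prod_eq_zero (Finset.mem_erase.2 ⟨hk.symm, Finset.mem_univ n⟩) (sub_self _), mul_zero]

theorem eq_zero_of_cauchy {z w y : ι → K} (hz : Function.Injective z)
    (hw : Function.Injective w) (hzw : ∀ j k, z j ≠ w k)
    (hy : ∀ j, ∑ k, y k / (z j - w k) = 0) : y = 0 := by
  funext n
  have h1 := sum_mul_prod_eq_of_cauchy n hz hzw (fun j _ => hy j) (hy n)
  have h2 := apply_mul_prod_eq_of_cauchy n hz hzw (fun j _ => hy j)
  have hz' : ∏ l ∈ Finset.univ.erase n, (z n - z l) ≠ 0 :=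
    Finset.prod_ne_zero_iff.2 fun l hl =>
      sub_ne_zero.2 fun h => Finset.ne_of_mem_erase hl (hz h).symm
  have hw' : ∏ l ∈ Finset.univ.erase n, (w n - w l) ≠ 0 :=
    Finset.prod_ne_zero_iff.2 fun l hl =>
      sub_ne_zero.2 fun h => Finset.ne_of_mem_erase hl (hw h).symm
  rw [zero_mul, mul_eq_zero, or_iff_left hz'] at h1
  rw [h1, zero_mul, mul_eq_zero, or_iff_left hw'] at h2
  exact h2

end Cauchy

/-! ### Factorization of `λ` and positivity of `c` and `d` -/

namespace SolitonData

variable {N m : ℕ} (D : SolitonData N m)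

theorem ζ_re (j : Fin N) : (D.ζ j).re = D.ξ j := by simp [ζ]

theorem ζ_im (j : Fin N) : (D.ζ j).im = D.η j := by simp [ζ]

theorem ζ_sub_conj_ne_zero (j k : Fin N) : D.ζ k - conj (D.ζ j) ≠ 0 := by
  intro h
  have := congrArg Complex.im h
  simp only [Complex.sub_im, Complex.conj_im, ζ_im, Complex.zero_im] at this
  linarith [D.η_pos j, D.η_pos k]

theorem ζ_sub_conj_self (j : Fin N) : D.ζ j - conj (D.ζ j) = 2 * Complex.I * D.η j := by
  apply Complex.ext <;> simp [ζ]
  ring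

theorem ζ_injective (hξ : Function.Injective D.ξ) : Function.Injective D.ζ := fun j k h =>
  hξ (by rw [← ζ_re, ← ζ_re, h])

theorem conj_c (j k : Fin N) : conj (D.c j k) = D.c k j := by
  have h1 := D.ζ_sub_conj_ne_zero k j
  have h2 : conj (D.ζ k) - D.ζ j ≠ 0 := by
    rw [← neg_sub]; exact neg_ne_zero.2 h1
  simp only [c, map_div₀, map_sub, Complex.conj_I, Complex.conj_conj]
  field_simp
  ring

theorem herm_self (j : Fin N) : D.herm j j = 1 := by
  simp [herm, inner_self_eq_norm_sq_to_K, D.norm_u]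

theorem conj_herm (j k : Fin N) : conj (D.herm j k) = D.herm k j := inner_conj_symm _ _

theorem d_eq (j k : Fin N) : D.d j k = D.c j k * D.herm j k := by
  simp only [d, c]; ring

theorem c_self (j : Fin N) : D.c j j = (2 * (D.η j : ℂ))⁻¹ := by
  have : (D.η j : ℂ) ≠ 0 := by exact_mod_cast (D.η_pos j).ne'
  rw [c, ζ_sub_conj_self]
  field_simp

theorem d_self (j : Fin N) : D.d j j = (2 * (D.η j : ℂ))⁻¹ := by
  rw [d_eq, c_self, herm_self, mul_one]

theorem lam_eq (j k l : Fin N) : D.lam j k l = 2 * (D.η l : ℂ) * D.d j l * D.c k l := by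
  have h1 := D.ζ_sub_conj_ne_zero k l
  have h2 := D.ζ_sub_conj_ne_zero j l
  simp only [lam, d, c]
  field_simp
  rw [Complex.I_sq]
  ring

theorem cMat_isHermitian {p : ℕ} (i : Fin p → Fin N) : (D.cMat i).IsHermitian := by
  ext a b; simp [cMat, conj_c]

/-- Exhibits `c` as a Gram matrix in `L²(0, ∞)`; the integral converges because every `η_j` is
positive. -/
theorem c_eq_integral (j k : Fin N) :
    D.c j k = ∫ s in Set.Ioi (0 : ℝ), Complex.exp (Complex.I * (D.ζ k - conj (D.ζ j)) * s) := by
  have hre : (Complex.I * (D.ζ k - conj (D.ζ j))).re < 0 := by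
    simp [ζ_im]; linarith [D.η_pos j, D.η_pos k]
  rw [integral_exp_mul_complex_Ioi hre]
  have h := D.ζ_sub_conj_ne_zero j k
  simp only [c, Complex.ofReal_zero, mul_zero, Complex.exp_zero]
  field_simp
  rw [Complex.I_sq]

theorem cMat_posSemidef : (D.cMat id).PosSemidef := by
  refine Matrix.PosSemidef.of_dotProduct_mulVec_nonneg (D.cMat_isHermitian id) fun x => ?_
  have hre : ∀ j k, (Complex.I * (D.ζ k - conj (D.ζ j))).re < 0 := by
    intro j k; simp [ζ_im]; linarith [D.η_pos j, D.η_pos k]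
  have hint : ∀ j k, MeasureTheory.Integrable (fun s : ℝ => conj (x j) *
      (Complex.exp (Complex.I * (D.ζ k - conj (D.ζ j)) * s) * x k))
      (MeasureTheory.volume.restrict (Set.Ioi 0)) := fun j k =>
    ((integrableOn_exp_mul_complex_Ioi (hre j k) 0).mul_const _).const_mul _
  have key : star x ⬝ᵥ (D.cMat id).mulVec x = ∫ s in Set.Ioi (0 : ℝ),
      (((‖∑ k, x k * Complex.exp (Complex.I * D.ζ k * s)‖ ^ 2 : ℝ)) : ℂ) := by
    simp only [dotProduct, Matrix.mulVec, cMat, Matrix.of_apply, id, c_eq_integral, Pi.star_apply,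
      Finset.mul_sum]
    simp_rw [← MeasureTheory.integral_mul_const, RCLike.star_def,
      ← MeasureTheory.integral_const_mul]
    rw [← Finset.sum_congr rfl fun j _ =>
      MeasureTheory.integral_finsetSum Finset.univ fun k _ => hint j k,
      ← MeasureTheory.integral_finsetSum Finset.univ fun j _ =>
        MeasureTheory.integrable_finsetSum _ fun k _ => hint j k]
    congr 1
    funext s
    rw [Complex.ofReal_pow, ← Complex.conj_mul', map_sum, Finset.sum_mul]
    refine Finset.sum_congr rfl fun j _ => ?_
    rw [Finset.mul_sum]
    refine Finset.sum_congr rfl fun k _ => ?_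
    rw [map_mul, ← Complex.exp_conj]
    have : Complex.exp (Complex.I * (D.ζ k - conj (D.ζ j)) * s) =
        Complex.exp (conj (Complex.I * D.ζ j * s)) * Complex.exp (Complex.I * D.ζ k * s) := by
      rw [← Complex.exp_add]
      congr 1
      simp only [map_mul, Complex.conj_I, Complex.conj_ofReal]
      ring
    rw [this]
    ring
  rw [key, integral_complex_ofReal]
  exact_mod_cast MeasureTheory.integral_nonneg fun s => by positivity

variable {D}

theorem cMat_mulVec_injective (hξ : Function.Injective D.ξ) {x : Fin N → ℂ}
    (hx : (D.cMat id).mulVec x = 0) : x = 0 := by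
  have hζ := D.ζ_injective hξ
  refine eq_zero_of_cauchy (z := fun j => conj (D.ζ j)) (w := D.ζ)
    (fun j k h => hζ (star_injective h)) hζ
    (fun j k h => D.ζ_sub_conj_ne_zero j k (sub_eq_zero.2 h.symm)) fun j => ?_
  have := congrFun hx j
  simp only [Matrix.mulVec, dotProduct, cMat, Matrix.of_apply, id, c, Pi.zero_apply] at this
  have h2 : ∑ k, Complex.I / (D.ζ k - conj (D.ζ j)) * x k =
      -Complex.I * ∑ k, x k / (conj (D.ζ j) - D.ζ k) := by
    rw [Finset.mul_sum]
    refine Finset.sum_congr rfl fun k _ => ?_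
    rw [← neg_sub (D.ζ k), div_neg]
    ring
  rw [h2, mul_eq_zero] at this
  exact this.resolve_left (by simp)

/-- A Gram matrix is semidefinite, and an invertible semidefinite matrix is definite; invertibility
is that of a Cauchy matrix with distinct nodes. -/
theorem cMat_id_posDef (hξ : Function.Injective D.ξ) : (D.cMat id).PosDef := by
  rw [D.cMat_posSemidef.posDef_iff_isUnit, ← Matrix.mulVec_injective_iff_isUnit]
  intro x y hxy
  refine sub_eq_zero.1 (cMat_mulVec_injective hξ ?_)
  rw [Matrix.mulVec_sub, sub_eq_zero]
  exact hxy

theorem dMat_id_posDef (hξ : Function.Injective D.ξ) : (D.dMat id).PosDef := by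
  have hc := cMat_id_posDef hξ
  refine Matrix.PosDef.of_dotProduct_mulVec_pos ?_ fun x hx => ?_
  · ext j k
    simp [dMat, d_eq, conj_c, conj_herm]
  -- Schur's product argument: the form of `d` is the sum, over the components of the polarizations,
  -- of forms of `c`. Some component of `u j` is nonzero, which makes one summand positive.
  · have key : star x ⬝ᵥ (D.dMat id).mulVec x = ∑ a : Fin m,
        star (fun k => x k * conj (D.u k a)) ⬝ᵥ
          (D.cMat id).mulVec (fun k => x k * conj (D.u k a)) := by
      simp only [dotProduct, Matrix.mulVec, dMat, cMat, Matrix.of_apply, id, d_eq, herm,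
        PiLp.inner_apply, Pi.star_apply, Finset.mul_sum, Finset.sum_mul]
      conv_rhs => rw [Finset.sum_comm]
      refine Finset.sum_congr rfl fun j _ => ?_
      rw [Finset.sum_comm]
      refine Finset.sum_congr rfl fun a _ => Finset.sum_congr rfl fun k _ => ?_
      simp
      ring
    rw [key]
    obtain ⟨j, hj⟩ := Function.ne_iff.1 hx
    have hu : D.u j ≠ 0 := by
      intro h; simpa [h] using D.norm_u j
    obtain ⟨a, ha⟩ : ∃ a, D.u j a ≠ 0 := by
      by_contra! h
      exact hu (PiLp.ext h)
    refine Finset.sum_pos' (fun a _ => hc.posSemidef.dotProduct_mulVec_nonneg _)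
      ⟨a, Finset.mem_univ _, hc.dotProduct_mulVec_pos ?_⟩
    exact Function.ne_iff.2 ⟨j, by simpa [ha] using hj⟩

theorem cMat_posDef (hξ : Function.Injective D.ξ) {p : ℕ} {i : Fin p → Fin N}
    (hi : Function.Injective i) : (D.cMat i).PosDef :=
  (cMat_id_posDef hξ).submatrix hi

theorem dMat_posDef (hξ : Function.Injective D.ξ) {p : ℕ} {i : Fin p → Fin N}
    (hi : Function.Injective i) : (D.dMat i).PosDef :=
  (dMat_id_posDef hξ).submatrix hi

end SolitonData

/-! ### Sums of determinants over arrangements -/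

section Determinants

variable {R : Type*} [CommRing R]

/-- For fixed `σ` the row factors come out and leave a row permutation of `Bᵀ`, whose determinant is
`sign σ * det B`; this sign turns the sum over `σ` into the Leibniz expansion of `det A`. -/
theorem sum_perm_det_eq {ι : Type*} [Fintype ι] [DecidableEq ι] (g : ι → R) (A B : Matrix ι ι R) :
    ∑ σ : Equiv.Perm ι, (Matrix.of fun a b => g (σ a) * A a (σ a) * B b (σ a)).det =
      (∏ a, g a) * A.det * B.det := by
  have h : ∀ σ : Equiv.Perm ι, (Matrix.of fun a b => g (σ a) * A a (σ a) * B b (σ a)).det =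
      (∏ a, g a) * ((Equiv.Perm.sign σ : ℤ) * ∏ a, Aᵀ (σ a) a) * B.det := by
    intro σ
    have h1 := Matrix.det_mul_column (fun a => g (σ a) * A a (σ a)) (Bᵀ.submatrix σ id)
    simp only [Matrix.submatrix_apply, Matrix.transpose_apply, id] at h1
    rw [h1, Matrix.det_permute, Matrix.det_transpose, Finset.prod_mul_distrib,
      Equiv.prod_comp σ g]
    simp only [Matrix.transpose_apply]
    ring
  simp_rw [h, ← Finset.sum_mul, ← Finset.mul_sum, ← Matrix.det_apply', Matrix.det_transpose]

theorem adjugate_last_apply {p : ℕ} (A : Matrix (Fin (p + 1)) (Fin (p + 1)) R) (j : Fin (p + 1)) :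
    A.adjugate (Fin.last p) j =
      (-1) ^ ((j : ℕ) + p) * (A.submatrix j.succAbove Fin.castSucc).det := by
  rw [Matrix.adjugate_fin_succ_eq_det_submatrix, Fin.val_last, Fin.succAbove_last]

theorem adjugate_last_last {p : ℕ} (A : Matrix (Fin (p + 1)) (Fin (p + 1)) R) :
    A.adjugate (Fin.last p) (Fin.last p) = (A.submatrix Fin.castSucc Fin.castSucc).det := by
  rw [adjugate_last_apply, Fin.val_last, Fin.succAbove_last, Even.neg_one_pow ⟨p, rfl⟩, one_mul]

theorem det_insertNth_one {p : ℕ} (j : Fin (p + 1)) (r : Fin p → Fin (p + 1) → R) :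
    (Matrix.of (j.insertNth (α := fun _ => Fin (p + 1) → R) (fun _ => 1) r)).det =
      ∑ b : Fin (p + 1), (-1) ^ ((j : ℕ) + b) *
        (Matrix.of fun a b' => r a (b.succAbove b')).det := by
  rw [Matrix.det_succ_row _ j]
  refine Finset.sum_congr rfl fun b _ => ?_
  have : (Matrix.of (j.insertNth (α := fun _ => Fin (p + 1) → R) (fun _ => 1) r)).submatrix
      j.succAbove b.succAbove = Matrix.of fun a b' => r a (b.succAbove b') := by
    ext a b'
    simp
  rw [this]
  simp

/-- Expanding along the row of ones leaves sums covered by `sum_perm_det_eq`. The resulting minors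
omit the last column, so with their signs they are entries of the last row of the adjugates. -/
theorem sum_perm_det_insertNth_one {p : ℕ} (j : Fin (p + 1)) (g : Fin p → R)
    (A B : Matrix (Fin (p + 1)) (Fin (p + 1)) R) :
    ∑ σ : Equiv.Perm (Fin p), (Matrix.of (j.insertNth (α := fun _ => Fin (p + 1) → R)
      (fun _ => 1) (fun a b => g (σ a) * A (j.succAbove a) (σ a).castSucc *
        B b (σ a).castSucc))).det =
      (∏ a, g a) * (∑ b, B.adjugate (Fin.last p) b) * A.adjugate (Fin.last p) j := by
  simp_rw [det_insertNth_one]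
  rw [Finset.sum_comm]
  simp_rw [← Finset.mul_sum]
  have h := fun b : Fin (p + 1) => sum_perm_det_eq g (A.submatrix j.succAbove Fin.castSucc)
    (B.submatrix b.succAbove Fin.castSucc)
  simp only [Matrix.submatrix_apply] at h
  simp_rw [h, adjugate_last_apply, Finset.mul_sum, Finset.sum_mul]
  refine Finset.sum_congr rfl fun b _ => ?_
  have hp : ((-1 : R) ^ p) * (-1) ^ p = 1 := by rw [← mul_pow]; simp
  simp only [pow_add]
  linear_combination (-((-1 : R) ^ (j : ℕ) * (-1) ^ (b : ℕ) *
    ((∏ a, g a) * (A.submatrix j.succAbove Fin.castSucc).det *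
      (B.submatrix b.succAbove Fin.castSucc).det))) * hp

theorem prod_univ_erase_last {M : Type*} [CommMonoid M] {p : ℕ} (f : Fin (p + 1) → M) :
    ∏ l ∈ Finset.univ.erase (Fin.last p), f l = ∏ l : Fin p, f l.castSucc := by
  rw [Fin.univ_castSuccEmb, Finset.erase_cons, Finset.prod_map]
  rfl

end Determinants

/-! ### Phase shifts and polarizations -/

namespace SolitonData

variable {N m : ℕ} {D : SolitonData N m}

theorem η_ne_zero (D : SolitonData N m) (j : Fin N) : (D.η j : ℂ) ≠ 0 := by
  exact_mod_cast (D.η_pos j).ne'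

theorem lam_self (D : SolitonData N m) (j : Fin N) : D.lam j j j = (2 * (D.η j : ℂ))⁻¹ := by
  have := D.η_ne_zero j
  rw [lam_eq, d_self, c_self]
  field_simp

theorem phiSum_eq (D : SolitonData N m) {p : ℕ} (i : Fin p → Fin N) :
    D.phiSum i = (∏ a, (2 * (D.η (i a) : ℂ))) ^ 2 * (D.dMat i).det * (D.cMat i).det := by
  have h := sum_perm_det_eq (fun a => 2 * (D.η (i a) : ℂ)) (D.dMat i) (D.cMat i)
  simp only [dMat, cMat, Matrix.of_apply] at h
  simp_rw [phiSum, lam_self, lam_eq, h, Finset.prod_inv_distrib, inv_inv]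
  simp only [dMat, cMat]
  ring

theorem phiSum_pos (hξ : Function.Injective D.ξ) {p : ℕ} {i : Fin p → Fin N}
    (hi : Function.Injective i) : 0 < D.phiSum i := by
  rw [phiSum_eq]
  have h : (∏ a, (2 * (D.η (i a) : ℂ))) ^ 2 = (((∏ a, (2 * D.η (i a))) ^ 2 : ℝ) : ℂ) := by
    push_cast; rfl
  have h' : 0 < (∏ a, (2 * D.η (i a))) ^ 2 :=
    pow_pos (Finset.prod_pos fun a _ => mul_pos two_pos (D.η_pos _)) 2
  rw [h]
  exact mul_pos (mul_pos (by exact_mod_cast h') (dMat_posDef hξ hi).det_pos)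
    (cMat_posDef hξ hi).det_pos

theorem exp_neg_two_mul_phi (hξ : Function.Injective D.ξ) {p : ℕ} {i : Fin p → Fin N}
    (hi : Function.Injective i) : ((Real.exp (-2 * D.phi i) : ℝ) : ℂ) = D.phiSum i := by
  have h := Complex.pos_iff.1 (phiSum_pos hξ hi)
  rw [phi, show -2 * (-Real.log (D.phiSum i).re / 2) = Real.log (D.phiSum i).re by ring,
    Real.exp_log h.1]
  exact Complex.ext rfl h.2

/-- The factor `∏ |(ζ_{i_l} - ζ_{i_n}) / (ζ_{i_l} - ζ_{i_n}^*)|²`. -/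
def absFactor (D : SolitonData N m) {p : ℕ} (i : Fin (p + 1) → Fin N) : ℂ :=
  ∏ l : Fin p, ((‖(D.ζ (i l.castSucc) - D.ζ (i (Fin.last p))) /
      (D.ζ (i l.castSucc) - conj (D.ζ (i (Fin.last p))))‖ ^ 2 : ℝ) : ℂ)

/-- The factor `∏ (ζ_{i_l}^* - ζ_{i_n}^*) / (ζ_{i_l} - ζ_{i_n}^*)`. -/
def phaseFactor (D : SolitonData N m) {p : ℕ} (i : Fin (p + 1) → Fin N) : ℂ :=
  ∏ l : Fin p, (conj (D.ζ (i l.castSucc)) - conj (D.ζ (i (Fin.last p)))) /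
        (D.ζ (i l.castSucc) - conj (D.ζ (i (Fin.last p))))

theorem absFactor_eq (D : SolitonData N m) {p : ℕ} (i : Fin (p + 1) → Fin N) :
    D.absFactor i =
      (∏ l : Fin p, (D.ζ (i (Fin.last p)) - D.ζ (i l.castSucc))) *
      (∏ l : Fin p, (conj (D.ζ (i (Fin.last p))) - conj (D.ζ (i l.castSucc)))) /
      ((∏ l : Fin p, (conj (D.ζ (i (Fin.last p))) - D.ζ (i l.castSucc))) *
      (∏ l : Fin p, (D.ζ (i (Fin.last p)) - conj (D.ζ (i l.castSucc))))) := by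
  rw [absFactor, ← Finset.prod_mul_distrib, ← Finset.prod_mul_distrib, ← Finset.prod_div_distrib]
  refine Finset.prod_congr rfl fun l _ => ?_
  rw [Complex.ofReal_pow, ← Complex.conj_mul', map_div₀, map_sub, map_sub, Complex.conj_conj,
    div_mul_div_comm]
  rw [← neg_sub (conj (D.ζ (i (Fin.last p)))), ← neg_sub (D.ζ (i (Fin.last p))),
    ← neg_sub (D.ζ (i (Fin.last p))), ← neg_sub (conj (D.ζ (i (Fin.last p))))]
  simp only [neg_mul_neg]
  congr 1 <;> ring

theorem phaseFactor_eq (D : SolitonData N m) {p : ℕ} (i : Fin (p + 1) → Fin N) :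
    D.phaseFactor i =
      (∏ l : Fin p, (conj (D.ζ (i (Fin.last p))) - conj (D.ζ (i l.castSucc)))) /
      (∏ l : Fin p, (conj (D.ζ (i (Fin.last p))) - D.ζ (i l.castSucc))) := by
  rw [phaseFactor, ← Finset.prod_div_distrib]
  refine Finset.prod_congr rfl fun l _ => ?_
  rw [← neg_sub, ← neg_sub (conj (D.ζ (i (Fin.last p)))), neg_div_neg_eq]

theorem cMat_det_ne_zero (hξ : Function.Injective D.ξ) {p : ℕ} {i : Fin p → Fin N}
    (hi : Function.Injective i) : (D.cMat i).det ≠ 0 := (cMat_posDef hξ hi).det_pos.ne'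

theorem dMat_det_ne_zero (hξ : Function.Injective D.ξ) {p : ℕ} {i : Fin p → Fin N}
    (hi : Function.Injective i) : (D.dMat i).det ≠ 0 := (dMat_posDef hξ hi).det_pos.ne'

theorem init_injective {α : Type*} {p : ℕ} {i : Fin (p + 1) → α} (hi : Function.Injective i) :
    Function.Injective (Fin.init i) := hi.comp (Fin.castSucc_injective p)

theorem cMat_inv_last_last (D : SolitonData N m) {p : ℕ} (i : Fin (p + 1) → Fin N) :
    (D.cMat i)⁻¹ (Fin.last p) (Fin.last p) = (D.cMat (Fin.init i)).det / (D.cMat i).det := by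
  rw [Matrix.inv_def, Matrix.smul_apply, adjugate_last_last, Ring.inverse_eq_inv', smul_eq_mul,
    inv_mul_eq_div]
  rfl

theorem dMat_inv_last_last (D : SolitonData N m) {p : ℕ} (i : Fin (p + 1) → Fin N) :
    (D.dMat i)⁻¹ (Fin.last p) (Fin.last p) = (D.dMat (Fin.init i)).det / (D.dMat i).det := by
  rw [Matrix.inv_def, Matrix.smul_apply, adjugate_last_last, Ring.inverse_eq_inv', smul_eq_mul,
    inv_mul_eq_div]
  rfl

theorem vecDet_eq (D : SolitonData N m) {p : ℕ} (i : Fin (p + 1) → Fin N) :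
    vecDet (Matrix.of fun r (b : Fin p) => D.d (i r) (i b.castSucc)) (fun r => D.u (i r)) =
      ∑ r, (D.dMat i).adjugate (Fin.last p) r • D.u (i r) := by
  simp_rw [vecDet, adjugate_last_apply]
  rfl

/-- The last row of `c⁻¹` solves a Cauchy system with nodes `ζ` and poles `ζ^*`, which is what the
interpolation lemmas take as input. -/
theorem sum_cMat_inv_last_div (hξ : Function.Injective D.ξ) {p : ℕ} {i : Fin (p + 1) → Fin N}
    (hi : Function.Injective i) (j : Fin (p + 1)) :
    ∑ k, (D.cMat i)⁻¹ (Fin.last p) k / (D.ζ (i j) - conj (D.ζ (i k))) =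
      if j = Fin.last p then -Complex.I else 0 := by
  have h := Matrix.nonsing_inv_mul (D.cMat i) (cMat_det_ne_zero hξ hi).isUnit
  have h1 := congrFun (congrFun h (Fin.last p)) j
  rw [Matrix.mul_apply, Matrix.one_apply] at h1
  have h2 : ∑ k, (D.cMat i)⁻¹ (Fin.last p) k / (D.ζ (i j) - conj (D.ζ (i k))) =
      -Complex.I * ∑ k, (D.cMat i)⁻¹ (Fin.last p) k * D.cMat i k j := by
    rw [Finset.mul_sum]
    refine Finset.sum_congr rfl fun k _ => ?_
    rw [show D.cMat i k j = Complex.I / (D.ζ (i j) - conj (D.ζ (i k))) from rfl]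
    linear_combination ((D.cMat i)⁻¹ (Fin.last p) k / (D.ζ (i j) - conj (D.ζ (i k)))) *
      Complex.I_sq
  rw [h2, h1]
  simp [eq_comm]

theorem sum_cMat_inv_last_mul_prod (hξ : Function.Injective D.ξ) {p : ℕ} {i : Fin (p + 1) → Fin N}
    (hi : Function.Injective i) :
    (∑ k, (D.cMat i)⁻¹ (Fin.last p) k) *
      ∏ l : Fin p, (D.ζ (i (Fin.last p)) - D.ζ (i l.castSucc)) =
      2 * D.η (i (Fin.last p)) *
        ∏ l : Fin p, (D.ζ (i (Fin.last p)) - conj (D.ζ (i l.castSucc))) := by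
  have h := sum_mul_prod_eq_of_cauchy (z := fun j => D.ζ (i j)) (w := fun j => conj (D.ζ (i j)))
    (y := (D.cMat i)⁻¹ (Fin.last p)) (t := -Complex.I) (Fin.last p)
    ((D.ζ_injective hξ).comp hi)
    (fun j k h => D.ζ_sub_conj_ne_zero (i k) (i j) (sub_eq_zero.2 h))
    (fun j hj => by rw [sum_cMat_inv_last_div hξ hi, if_neg hj])
    (by rw [sum_cMat_inv_last_div hξ hi, if_pos rfl])
  rw [prod_univ_erase_last, Fin.prod_univ_castSucc, ζ_sub_conj_self] at h
  rw [h]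
  linear_combination (-2 * D.η (i (Fin.last p)) *
    ∏ l : Fin p, (D.ζ (i (Fin.last p)) - conj (D.ζ (i l.castSucc)))) * Complex.I_sq

theorem sum_cMat_inv_last (hξ : Function.Injective D.ξ) {p : ℕ} {i : Fin (p + 1) → Fin N}
    (hi : Function.Injective i) :
    ∑ k, (D.cMat i)⁻¹ (Fin.last p) k =
      (D.cMat i)⁻¹ (Fin.last p) (Fin.last p) * D.phaseFactor i := by
  have h := apply_mul_prod_eq_of_cauchy (z := fun j => D.ζ (i j))
    (w := fun j => conj (D.ζ (i j)))
    (y := (D.cMat i)⁻¹ (Fin.last p)) (Fin.last p)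
    ((D.ζ_injective hξ).comp hi)
    (fun j k h => D.ζ_sub_conj_ne_zero (i k) (i j) (sub_eq_zero.2 h))
    (fun j hj => by rw [sum_cMat_inv_last_div hξ hi, if_neg hj])
  rw [prod_univ_erase_last, prod_univ_erase_last] at h
  have h0 : ∏ l : Fin p, (conj (D.ζ (i (Fin.last p))) - D.ζ (i l.castSucc)) ≠ 0 :=
    Finset.prod_ne_zero_iff.2 fun l _ h =>
      D.ζ_sub_conj_ne_zero (i (Fin.last p)) (i l.castSucc) (by rw [← neg_sub, h, neg_zero])
  rw [phaseFactor_eq, ← mul_div_assoc, eq_div_iff h0, ← h]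

/-- Comparing the two evaluations of the interpolation identity eliminates the row sum; this is the
ratio of consecutive Cauchy determinants. -/
theorem cMat_inv_last_last_mul_absFactor (hξ : Function.Injective D.ξ) {p : ℕ} {i : Fin (p + 1) → Fin N}
    (hi : Function.Injective i) :
    (D.cMat i)⁻¹ (Fin.last p) (Fin.last p) * D.absFactor i = 2 * D.η (i (Fin.last p)) := by
  have h1 := sum_cMat_inv_last_mul_prod hξ hi
  rw [sum_cMat_inv_last hξ hi, phaseFactor_eq] at h1
  have h0 : ∏ l : Fin p, (D.ζ (i (Fin.last p)) - conj (D.ζ (i l.castSucc))) ≠ 0 :=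
    Finset.prod_ne_zero_iff.2 fun l _ => D.ζ_sub_conj_ne_zero _ _
  have h2 : ∏ l : Fin p, (conj (D.ζ (i (Fin.last p))) - D.ζ (i l.castSucc)) ≠ 0 :=
    Finset.prod_ne_zero_iff.2 fun l _ h =>
      D.ζ_sub_conj_ne_zero (i (Fin.last p)) (i l.castSucc) (by rw [← neg_sub, h, neg_zero])
  rw [absFactor_eq]
  field_simp at h1 ⊢
  linear_combination h1

/-- In the ratio of two `phiSum`s the `c` determinants contribute `absFactor / (2 η_n)` and the
prefactors `(2 η_n)²`; the remaining `2 η_n` is `1 / d_{nn}`. -/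
theorem exp_neg_two_mul_phaseShift (hξ : Function.Injective D.ξ) {p : ℕ} {i : Fin (p + 1) → Fin N}
    (hi : Function.Injective i) :
    ((Real.exp (-2 * D.phaseShift i) : ℝ) : ℂ) = D.phaseShiftFormula i := by
  have hη := D.η_ne_zero (i (Fin.last p))
  have hd := dMat_det_ne_zero hξ hi
  have hc := cMat_det_ne_zero hξ hi
  have hd' := dMat_det_ne_zero hξ (init_injective hi)
  have hc' := cMat_det_ne_zero hξ (init_injective hi)
  have hP := cMat_inv_last_last_mul_absFactor hξ hi
  rw [D.cMat_inv_last_last i] at hP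
  have h : Real.exp (-2 * D.phaseShift i) =
      Real.exp (-2 * D.phi i) / Real.exp (-2 * D.phi (Fin.init i)) := by
    rw [← Real.exp_sub, phaseShift]
    congr 1
    ring
  rw [h, Complex.ofReal_div, exp_neg_two_mul_phi hξ hi, exp_neg_two_mul_phi hξ (init_injective hi),
    phiSum_eq, phiSum_eq, Fin.prod_univ_castSucc]
  have h0 : ∏ a : Fin p, (2 * (D.η (i a.castSucc) : ℂ)) ≠ 0 :=
    Finset.prod_ne_zero_iff.2 fun a _ => mul_ne_zero two_ne_zero (D.η_ne_zero _)
  rw [phaseShiftFormula, ← absFactor, d_self]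
  simp only [Fin.init]
  change _ / (_ * (D.dMat (Fin.init i)).det * (D.cMat (Fin.init i)).det) =
    _ * (_ / (_ * (D.dMat (Fin.init i)).det))
  field_simp at hP ⊢
  linear_combination (-1 : ℂ) * hP

/-- Writing `e^{φ_i + φ_init}` as `e^{φ_i - φ_init}` divided by `phiSum` of the initial part cancels
the powers of `η`. What is left of `c` is the row sum of its adjugate over the smaller determinant,
namely `phaseFactor`. -/
theorem polarization_eq_polarizationFormula (hξ : Function.Injective D.ξ) {p : ℕ}
    {i : Fin (p + 1) → Fin N} (hi : Function.Injective i) : D.polarization i = D.polarizationFormula i := by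
  have hc := cMat_det_ne_zero hξ hi
  have hd' := dMat_det_ne_zero hξ (init_injective hi)
  have hc' := cMat_det_ne_zero hξ (init_injective hi)
  have hS := sum_cMat_inv_last hξ hi
  rw [D.cMat_inv_last_last i, Matrix.inv_def] at hS
  simp only [Matrix.smul_apply, Ring.inverse_eq_inv', smul_eq_mul, ← Finset.mul_sum] at hS
  have h : ∀ j : Fin (p + 1), ∑ σ : Equiv.Perm (Fin p),
      (Matrix.of (j.insertNth (α := fun _ => Fin (p + 1) → ℂ) (fun _ => 1)
        (fun a b => D.lam (i (j.succAbove a)) (i b) (i (σ a).castSucc)))).det =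
      (∏ a : Fin p, (2 * (D.η (i a.castSucc) : ℂ))) *
        (∑ b, (D.cMat i).adjugate (Fin.last p) b) * (D.dMat i).adjugate (Fin.last p) j := by
    intro j
    simp_rw [lam_eq]
    exact sum_perm_det_insertNth_one j
      (fun a : Fin p => 2 * (D.η (i a.castSucc) : ℂ)) (D.dMat i) (D.cMat i)
  have hφ := exp_neg_two_mul_phi hξ (init_injective hi)
  rw [phiSum_eq] at hφ
  change _ = (∏ a : Fin p, (2 * (D.η (i a.castSucc) : ℂ))) ^ 2 * _ * _ at hφ
  have hexp : Complex.exp ((D.phi i + D.phi (Fin.init i) : ℝ) : ℂ) *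
      ((Real.exp (-2 * D.phi (Fin.init i)) : ℝ) : ℂ) = Complex.exp (D.phaseShift i : ℂ) := by
    rw [Complex.ofReal_exp, ← Complex.exp_add, phaseShift]
    congr 1
    push_cast
    ring
  rw [hφ] at hexp
  rw [polarization, polarizationFormula, ← phaseFactor]
  simp_rw [vecDet_eq, ← Finset.sum_smul, h,
    mul_smul, ← Finset.smul_sum, ← mul_smul, lam_self, Finset.prod_inv_distrib, inv_inv, ← hexp]
  congr 1
  field_simp at hS ⊢
  linear_combination (∏ a : Fin p, (2 * (D.η (i a.castSucc) : ℂ))) ^ 2 * hS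

theorem exists_perm_of_range_eq {ι α : Type*} {i i' : ι → α} (hi : Function.Injective i)
    (hi' : Function.Injective i') (h : Set.range i = Set.range i') :
    ∃ e : Equiv.Perm ι, i' = i ∘ e :=
  ⟨(Equiv.ofInjective i' hi').trans ((Equiv.setCongr h.symm).trans (Equiv.ofInjective i hi).symm),
    funext fun a => by simp [Equiv.apply_ofInjective_symm]⟩

theorem range_init {α : Type*} {p : ℕ} {i : Fin (p + 1) → α} (hi : Function.Injective i) :
    Set.range (Fin.init i) = Set.range i \ {i (Fin.last p)} := by
  ext x
  constructor
  · rintro ⟨a, rfl⟩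
    exact ⟨⟨a.castSucc, rfl⟩, fun h => (Fin.castSucc_lt_last a).ne (hi h)⟩
  · rintro ⟨⟨a, rfl⟩, ha⟩
    induction a using Fin.lastCases with
    | last => exact absurd rfl ha
    | cast a => exact ⟨a, rfl⟩

theorem det_dMat_comp_perm (D : SolitonData N m) {p : ℕ} (i : Fin p → Fin N)
    (e : Equiv.Perm (Fin p)) : (D.dMat (i ∘ e)).det = (D.dMat i).det :=
  Matrix.det_submatrix_equiv_self e (D.dMat i)

theorem phi_comp_perm (D : SolitonData N m) {p : ℕ} (i : Fin p → Fin N)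
    (e : Equiv.Perm (Fin p)) : D.phi (i ∘ e) = D.phi i := by
  have hc : (D.cMat (i ∘ e)).det = (D.cMat i).det :=
    Matrix.det_submatrix_equiv_self e (D.cMat i)
  rw [phi, phi, phiSum_eq, phiSum_eq, det_dMat_comp_perm, hc]
  simp only [Function.comp_apply]
  rw [Equiv.prod_comp e fun a => 2 * (D.η (i a) : ℂ)]

theorem phaseShift_eq_and_polarization_eq_of_range_eq (hξ : Function.Injective D.ξ) {p : ℕ}
    {i i' : Fin (p + 1) → Fin N} (hi : Function.Injective i) (hi' : Function.Injective i')
    (hlast : i (Fin.last p) = i' (Fin.last p)) (h : Set.range i = Set.range i') :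
    D.phaseShift i = D.phaseShift i' ∧ D.polarization i = D.polarization i' := by
  obtain ⟨e, he⟩ := exists_perm_of_range_eq hi hi' h
  obtain ⟨f, hf⟩ := exists_perm_of_range_eq (init_injective hi) (init_injective hi')
    (by rw [range_init hi, range_init hi', h, hlast])
  -- The permutation fixes the last index, so last rows of adjugates correspond.
  have hel : e (Fin.last p) = Fin.last p := hi (by rw [hlast, he]; rfl)
  have hps : D.phaseShift i' = D.phaseShift i := by
    rw [phaseShift, phaseShift, hf, phi_comp_perm, he, phi_comp_perm]
  have hpf : D.phaseFactor i' = D.phaseFactor i := by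
    have hf' : ∀ l, i' (Fin.castSucc l) = i (f l).castSucc := fun l => congrFun hf l
    simp_rw [phaseFactor, hf', ← hlast]
    exact Equiv.prod_comp f fun l : Fin p =>
      (conj (D.ζ (i l.castSucc)) - conj (D.ζ (i (Fin.last p)))) /
        (D.ζ (i l.castSucc) - conj (D.ζ (i (Fin.last p))))
  have hadj : ∀ r, (D.dMat i').adjugate (Fin.last p) r =
      (D.dMat i).adjugate (Fin.last p) (e r) := by
    intro r
    have h1 : D.dMat i' = (D.dMat i).submatrix e e := by rw [he]; rfl
    rw [h1, Matrix.adjugate_submatrix_equiv_self, Matrix.submatrix_apply, hel]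
  refine ⟨hps.symm, ?_⟩
  rw [polarization_eq_polarizationFormula hξ hi, polarization_eq_polarizationFormula hξ hi',
    polarizationFormula, polarizationFormula, vecDet_eq, vecDet_eq, ← phaseFactor, ← phaseFactor,
    hps, hpf, hf, det_dMat_comp_perm]
  simp_rw [hadj]
  congr 1
  rw [he]
  exact (Equiv.sum_comp e fun r => (D.dMat i).adjugate (Fin.last p) r • D.u (i r)).symm

theorem phaseShift_const (hξ : Function.Injective D.ξ) (n : Fin N) :
    D.phaseShift (fun _ : Fin 1 => n) = 0 := by
  have hi : Function.Injective (fun _ : Fin 1 => n) := fun a b _ => Subsingleton.elim a b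
  have hd : D.d n n ≠ 0 := by
    rw [d_self]; exact inv_ne_zero (mul_ne_zero two_ne_zero (D.η_ne_zero n))
  have hf : D.phaseShiftFormula (fun _ : Fin 1 => n) = 1 := by
    simp [phaseShiftFormula, dMat, hd]
  have h := exp_neg_two_mul_phaseShift hξ hi
  rw [hf] at h
  have h' : Real.exp (-2 * D.phaseShift (fun _ : Fin 1 => n)) = 1 := by exact_mod_cast h
  rw [Real.exp_eq_one_iff] at h'
  linarith

theorem polarization_const (hξ : Function.Injective D.ξ) (n : Fin N) :
    D.polarization (fun _ : Fin 1 => n) = D.u n := by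
  have hi : Function.Injective (fun _ : Fin 1 => n) := fun a b _ => Subsingleton.elim a b
  rw [polarization_eq_polarizationFormula hξ hi, polarizationFormula, phaseShift_const hξ]
  simp [vecDet]

/-! ### Extension of the solution to homogeneous coordinates -/

/-- The transpose of `(c_{jk})⁻¹`. -/
def cInv (D : SolitonData N m) : Matrix (Fin N) (Fin N) ℂ := ((D.cMat id)ᵀ)⁻¹

/-- The matrix `B C B^* + A d A^*`, where `A = diag a`, `B = diag b` and `C` is the inverse transpose
of `c`. With `b_j / a_j = e^{τ_j + α_j + iΘ_j} / (2 η_j)` it is equivalent to the matrix `U`, but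
it is meaningful as long as no pair `(a_j, b_j)` vanishes. -/
def homMat (D : SolitonData N m) (a b : Fin N → ℂ) : Matrix (Fin N) (Fin N) ℂ :=
  Matrix.diagonal b * D.cInv * (Matrix.diagonal b)ᴴ +
    Matrix.diagonal a * D.dMat id * (Matrix.diagonal a)ᴴ

/-- The row vector `(1, …, 1) C B^* (B C B^* + A d A^*)⁻¹`. -/
def homRow (D : SolitonData N m) (a b : Fin N → ℂ) : Fin N → ℂ :=
  (fun _ => 1) ᵥ* (D.cInv * (Matrix.diagonal b)ᴴ * (D.homMat a b)⁻¹)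

/-- The `N`-soliton solution as a function of the homogeneous coordinates `(a_j : b_j)` of
`e^{τ_j + α_j + iΘ_j} / (2 η_j)`. -/
def homSol (D : SolitonData N m) (a b : Fin N → ℂ) : EuclideanSpace ℂ (Fin m) :=
  (2 : ℂ) • ∑ j, (D.homRow a b j * a j) • D.u j

theorem cInv_posDef (hξ : Function.Injective D.ξ) : D.cInv.PosDef :=
  (cMat_id_posDef hξ).transpose.inv

theorem cInv_mul_transpose (hξ : Function.Injective D.ξ) : D.cInv * (D.cMat id)ᵀ = 1 :=
  Matrix.nonsing_inv_mul _
    ((Matrix.isUnit_iff_isUnit_det _).1 (cMat_id_posDef hξ).transpose.isUnit)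

theorem transpose_mul_cInv (hξ : Function.Injective D.ξ) : (D.cMat id)ᵀ * D.cInv = 1 :=
  Matrix.mul_nonsing_inv _
    ((Matrix.isUnit_iff_isUnit_det _).1 (cMat_id_posDef hξ).transpose.isUnit)

/-- The form at `x` is that of `C` at `b^* x` plus that of `d` at `a^* x`; where `x j ≠ 0`, one of
these two vectors is nonzero. -/
theorem homMat_posDef (hξ : Function.Injective D.ξ) {a b : Fin N → ℂ}
    (hab : ∀ j, a j ≠ 0 ∨ b j ≠ 0) : (D.homMat a b).PosDef := by
  have hC := cInv_posDef hξ
  have hd := dMat_id_posDef hξ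
  have h1 := hC.posSemidef.mul_mul_conjTranspose_same (Matrix.diagonal b)
  have h2 := hd.posSemidef.mul_mul_conjTranspose_same (Matrix.diagonal a)
  have key : ∀ (A : Matrix (Fin N) (Fin N) ℂ) (f x : Fin N → ℂ),
      star x ⬝ᵥ ((Matrix.diagonal f * A * (Matrix.diagonal f)ᴴ) *ᵥ x) =
        star (star f * x) ⬝ᵥ (A *ᵥ (star f * x)) := by
    intro A f x
    have : (Matrix.diagonal f)ᴴ *ᵥ x = star f * x := by
      ext j; simp [Matrix.diagonal_conjTranspose, Matrix.mulVec_diagonal]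
    rw [← Matrix.mulVec_mulVec, this, ← Matrix.mulVec_mulVec, Matrix.dotProduct_mulVec]
    congr 1
    ext j
    simp [Matrix.vecMul_diagonal, mul_comm]
  refine Matrix.PosDef.of_dotProduct_mulVec_pos (h1.add h2).isHermitian fun x hx => ?_
  obtain ⟨j, hj⟩ := Function.ne_iff.1 hx
  rw [homMat, Matrix.add_mulVec, dotProduct_add, key, key]
  rcases hab j with h | h
  · refine add_pos_of_nonneg_of_pos (hC.posSemidef.dotProduct_mulVec_nonneg _)
      (hd.dotProduct_mulVec_pos (Function.ne_iff.2 ⟨j, ?_⟩))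
    simpa [h] using hj
  · refine add_pos_of_pos_of_nonneg (hC.dotProduct_mulVec_pos (Function.ne_iff.2 ⟨j, ?_⟩))
      (hd.posSemidef.dotProduct_mulVec_nonneg _)
    simpa [h] using hj

theorem homRow_vecMul (hξ : Function.Injective D.ξ) {a b : Fin N → ℂ}
    (hab : ∀ j, a j ≠ 0 ∨ b j ≠ 0) :
    D.homRow a b ᵥ* D.homMat a b = (fun _ => 1) ᵥ* (D.cInv * (Matrix.diagonal b)ᴴ) := by
  have h := Matrix.nonsing_inv_mul (D.homMat a b)
    ((Matrix.isUnit_iff_isUnit_det _).1 (homMat_posDef hξ hab).isUnit)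
  rw [homRow, Matrix.vecMul_vecMul, Matrix.mul_assoc, h, Matrix.mul_one]

theorem homRow_equation (hξ : Function.Injective D.ξ) {a b : Fin N → ℂ}
    (hab : ∀ j, a j ≠ 0 ∨ b j ≠ 0) (k : Fin N) :
    ((fun j => D.homRow a b j * b j - 1) ᵥ* D.cInv) k * conj (b k) +
      ((fun j => D.homRow a b j * a j) ᵥ* D.dMat id) k * conj (a k) = 0 := by
  have h := congrFun (homRow_vecMul hξ hab) k
  rw [homMat, Matrix.vecMul_add, ← Matrix.vecMul_vecMul, ← Matrix.vecMul_vecMul,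
    ← Matrix.vecMul_vecMul, ← Matrix.vecMul_vecMul, ← Matrix.vecMul_vecMul, Pi.add_apply,
    Matrix.diagonal_conjTranspose, Matrix.diagonal_conjTranspose, Matrix.vecMul_diagonal,
    Matrix.vecMul_diagonal, Matrix.vecMul_diagonal] at h
  have e : ∀ f : Fin N → ℂ, D.homRow a b ᵥ* Matrix.diagonal f = fun j => D.homRow a b j * f j :=
    fun f => funext fun j => Matrix.vecMul_diagonal _ _ _
  rw [e, e] at h
  have h2 : (fun j => D.homRow a b j * b j - 1) =
      (fun j => D.homRow a b j * b j) - fun _ => (1 : ℂ) := rfl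
  rw [h2, Matrix.sub_vecMul, Pi.sub_apply, sub_mul]
  simp only [Pi.star_apply, RCLike.star_def] at h
  linear_combination h

theorem sum_range_eq {M : Type*} [AddCommMonoid M] {p : ℕ} {i : Fin p → Fin N}
    (hi : Function.Injective i) (f : Fin N → M) (hf : ∀ k, k ∉ Set.range i → f k = 0) :
    ∑ k, f k = ∑ r, f (i r) :=
  (Fintype.sum_of_injective i hi _ _ (fun k hk => hf k hk) fun _ => rfl).symm

/-- Vanishing coordinates decouple `homRow_equation`. Where `b = 0` it forces `v d = 0`, so `v` is a
multiple `s` of the last row of the inverse of the `d` block; where `a = 0` it forces `w = 0`, so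
`g` is governed by the `c` block. One scalar equation at `n` then fixes `s`. -/
theorem homSol_eq_smul_sum (hξ : Function.Injective D.ξ) {a b : Fin N → ℂ}
    (hab : ∀ j, a j ≠ 0 ∨ b j ≠ 0) {p : ℕ} {i : Fin (p + 1) → Fin N}
    (hi : Function.Injective i) (hb : ∀ l : Fin p, b (i l.castSucc) = 0)
    (ha : ∀ k, k ∉ Set.range i → a k = 0) :
    D.homSol a b = (2 * (a (i (Fin.last p)) * conj (b (i (Fin.last p))) *
        ∑ r, (D.cMat i)⁻¹ (Fin.last p) r) /
      (a (i (Fin.last p)) * conj (a (i (Fin.last p))) +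
        b (i (Fin.last p)) * conj (b (i (Fin.last p))) * (D.cMat i)⁻¹ (Fin.last p) (Fin.last p) *
          (D.dMat i)⁻¹ (Fin.last p) (Fin.last p))) •
      ∑ r, (D.dMat i)⁻¹ (Fin.last p) r • D.u (i r) := by
  set n := i (Fin.last p) with hn
  set v : Fin N → ℂ := fun j => D.homRow a b j * a j with hv
  set g : Fin N → ℂ := fun j => D.homRow a b j * b j - 1 with hg
  have heq : ∀ k, (g ᵥ* D.cInv) k * conj (b k) + (v ᵥ* D.dMat id) k * conj (a k) = 0 :=
    homRow_equation hξ hab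
  set s := (v ᵥ* D.dMat id) n with hs
  have hv0 : ∀ k, k ∉ Set.range i → v k = 0 := fun k hk => by simp [hv, ha k hk]
  have hvd : ∀ r, ((fun r => v (i r)) ᵥ* D.dMat i) r = (v ᵥ* D.dMat id) (i r) := by
    intro r
    simp only [Matrix.vecMul, dotProduct]
    rw [sum_range_eq hi _ fun k hk => by rw [hv0 k hk, zero_mul]]
    rfl
  have hvd' : (fun r => v (i r)) ᵥ* D.dMat i = Pi.single (Fin.last p) s := by
    funext r
    rw [hvd]
    induction r using Fin.lastCases with
    | last => rw [Pi.single_eq_same]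
    | cast l =>
      rw [Pi.single_eq_of_ne (Fin.castSucc_lt_last l).ne]
      have h := heq (i l.castSucc)
      rw [hb l, map_zero, mul_zero, zero_add, mul_eq_zero] at h
      exact h.resolve_right fun h' =>
        (hab (i l.castSucc)).elim (fun h'' => h'' ((map_eq_zero _).1 h')) fun h'' => h'' (hb l)
  have hvi : ∀ r, v (i r) = s * (D.dMat i)⁻¹ (Fin.last p) r := by
    intro r
    have h := congrArg (fun w => (w ᵥ* (D.dMat i)⁻¹) r) hvd'
    simp only [Matrix.vecMul_vecMul] at h
    rw [Matrix.mul_nonsing_inv _ (dMat_det_ne_zero hξ hi).isUnit, Matrix.vecMul_one,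
      Matrix.single_vecMul] at h
    simpa using h
  set w := g ᵥ* D.cInv with hw
  have hw0 : ∀ k, k ∉ Set.range i → w k = 0 := by
    intro k hk
    have h := heq k
    rw [ha k hk, map_zero, mul_zero, add_zero, mul_eq_zero] at h
    exact h.resolve_right fun h' =>
        (hab k).elim (fun h'' => h'' (ha k hk)) fun h'' => h'' ((map_eq_zero _).1 h')
  have hgw : ∀ r, g (i r) = ∑ r', w (i r') * D.cMat i r r' := by
    intro r
    have h : g = w ᵥ* (D.cMat id)ᵀ := by
      rw [hw, Matrix.vecMul_vecMul, cInv_mul_transpose hξ, Matrix.vecMul_one]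
    rw [congrFun h (i r)]
    simp only [Matrix.vecMul, dotProduct]
    rw [sum_range_eq hi _ fun k hk => by rw [hw0 k hk, zero_mul]]
    rfl
  have hwn : w n = ∑ r, (D.cMat i)⁻¹ (Fin.last p) r * g (i r) := by
    have h := Matrix.nonsing_inv_mul (D.cMat i) (cMat_det_ne_zero hξ hi).isUnit
    simp_rw [hgw, Finset.mul_sum]
    rw [Finset.sum_comm]
    have h2 : ∀ r', ∑ r, (D.cMat i)⁻¹ (Fin.last p) r * (w (i r') * D.cMat i r r') =
        w (i r') * (1 : Matrix (Fin (p + 1)) (Fin (p + 1)) ℂ) (Fin.last p) r' := by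
      intro r'
      rw [← h, Matrix.mul_apply, Finset.mul_sum]
      exact Finset.sum_congr rfl fun r _ => by ring
    simp_rw [h2, Matrix.one_apply]
    simp [hn]
  have hwn' : w n = D.homRow a b n * b n * (D.cMat i)⁻¹ (Fin.last p) (Fin.last p) -
      ∑ r, (D.cMat i)⁻¹ (Fin.last p) r := by
    rw [hwn]
    have h : ∀ r, g (i r) = (if r = Fin.last p then D.homRow a b n * b n else 0) - 1 := by
      intro r
      induction r using Fin.lastCases with
      | last => simp [hg, hn]
      | cast l => simp [hg, hb l, (Fin.castSucc_lt_last l).ne]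
    simp_rw [h, mul_sub, mul_ite, mul_zero, mul_one, Finset.sum_sub_distrib]
    simp [mul_comm]
  have hvn : D.homRow a b n * a n = s * (D.dMat i)⁻¹ (Fin.last p) (Fin.last p) :=
    hvi (Fin.last p)
  have hden : a n * conj (a n) + b n * conj (b n) * (D.cMat i)⁻¹ (Fin.last p) (Fin.last p) *
      (D.dMat i)⁻¹ (Fin.last p) (Fin.last p) ≠ 0 := by
    have h1 : 0 < (D.cMat i)⁻¹ (Fin.last p) (Fin.last p) := (cMat_posDef hξ hi).inv.diag_pos
    have h2 : 0 < (D.dMat i)⁻¹ (Fin.last p) (Fin.last p) := (dMat_posDef hξ hi).inv.diag_pos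
    rw [mul_assoc]
    have h3 := mul_pos h1 h2
    rcases hab n with h | h
    · exact (add_pos_of_pos_of_nonneg (mul_star_self_pos h.isUnit.isRegular)
        (mul_nonneg (mul_star_self_nonneg _) h3.le)).ne'
    · exact (add_pos_of_nonneg_of_pos (mul_star_self_nonneg _)
        (mul_pos (mul_star_self_pos h.isUnit.isRegular) h3)).ne'
  have hsv : s = a n * conj (b n) * (∑ r, (D.cMat i)⁻¹ (Fin.last p) r) /
      (a n * conj (a n) + b n * conj (b n) * (D.cMat i)⁻¹ (Fin.last p) (Fin.last p) *
        (D.dMat i)⁻¹ (Fin.last p) (Fin.last p)) := by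
    rw [eq_div_iff hden]
    have h := heq n
    rw [hwn'] at h
    -- Eliminates `homRow n` without dividing by `a n` or `b n`, either of which may be zero.
    linear_combination a n * h - b n * conj (b n) * (D.cMat i)⁻¹ (Fin.last p) (Fin.last p) * hvn
  have hsum : ∑ j, v j • D.u j = s • ∑ r, (D.dMat i)⁻¹ (Fin.last p) r • D.u (i r) := by
    rw [sum_range_eq hi _ fun k hk => by rw [hv0 k hk, zero_smul], Finset.smul_sum]
    simp_rw [hvi, mul_smul]
  rw [homSol, hsum, smul_smul, hsv, ← mul_div_assoc]

/-- A single soliton as a function of the homogeneous coordinates `(a : b)` of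
`e^{τ_n + α_n + iΘ_n} / (2 η_n)`. -/
def homSoliton (D : SolitonData N m) {p : ℕ} (i : Fin (p + 1) → Fin N) (a b : ℂ) :
    EuclideanSpace ℂ (Fin m) :=
  (8 * (D.η (i (Fin.last p)) : ℂ) ^ 2 * a * conj b * (Real.exp (-D.phaseShift i) : ℂ) /
    ((4 * D.η (i (Fin.last p)) ^ 2 * ‖b‖ ^ 2 + ‖a‖ ^ 2 * Real.exp (-D.phaseShift i) ^ 2 : ℝ) : ℂ))
    • D.polarization i

theorem homSol_eq_homSoliton (hξ : Function.Injective D.ξ) {a b : Fin N → ℂ}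
    (hab : ∀ j, a j ≠ 0 ∨ b j ≠ 0) {p : ℕ} {i : Fin (p + 1) → Fin N}
    (hi : Function.Injective i) (hb : ∀ l : Fin p, b (i l.castSucc) = 0)
    (ha : ∀ k, k ∉ Set.range i → a k = 0) :
    D.homSol a b = D.homSoliton i (a (i (Fin.last p))) (b (i (Fin.last p))) := by
  rw [homSol_eq_smul_sum hξ hab hi hb ha, homSoliton, polarization_eq_polarizationFormula hξ hi,
    polarizationFormula, ← phaseFactor, vecDet_eq, sum_cMat_inv_last hξ hi]
  have hη := D.η_ne_zero (i (Fin.last p))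
  have hd := dMat_det_ne_zero hξ hi
  have hd' := dMat_det_ne_zero hξ (init_injective hi)
  have hP := cMat_inv_last_last_mul_absFactor hξ hi
  have h1 : 0 < (D.cMat i)⁻¹ (Fin.last p) (Fin.last p) := (cMat_posDef hξ hi).inv.diag_pos
  have h2 : 0 < (D.dMat i)⁻¹ (Fin.last p) (Fin.last p) := (dMat_posDef hξ hi).inv.diag_pos
  have hφ := exp_neg_two_mul_phaseShift hξ hi
  rw [phaseShiftFormula, ← absFactor, d_self] at hφ
  have hE : Real.exp (-2 * D.phaseShift i) = Real.exp (-D.phaseShift i) ^ 2 := by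
    rw [← Real.exp_nat_mul]; congr 1; push_cast; ring
  have hE' : Complex.exp (D.phaseShift i : ℂ) * (Real.exp (-D.phaseShift i) : ℂ) = 1 := by
    rw [← Complex.ofReal_exp, ← Complex.ofReal_mul, ← Real.exp_add]; simp
  have hinv : ∀ r, (D.dMat i)⁻¹ (Fin.last p) r =
      (D.dMat i).det⁻¹ * (D.dMat i).adjugate (Fin.last p) r := by
    intro r
    rw [Matrix.inv_def, Matrix.smul_apply, Ring.inverse_eq_inv', smul_eq_mul]
  have hD := D.dMat_inv_last_last i
  simp_rw [hinv (_ : Fin (p + 1)), mul_smul, ← Finset.smul_sum, ← mul_smul, ← hinv (Fin.last p)]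
  congr 1
  rw [hE] at hφ
  push_cast at hφ hE' ⊢
  rw [← Complex.mul_conj', ← Complex.mul_conj']
  generalize a (i (Fin.last p)) * conj (a (i (Fin.last p))) = aa
  generalize b (i (Fin.last p)) * conj (b (i (Fin.last p))) = bb
  generalize a (i (Fin.last p)) = a, conj (b (i (Fin.last p))) = b
  generalize (D.cMat i)⁻¹ (Fin.last p) (Fin.last p) = y at *
  generalize (D.dMat i)⁻¹ (Fin.last p) (Fin.last p) = z at *
  generalize Complex.exp (D.phaseShift i : ℂ) = e at *
  generalize Complex.exp (-(D.phaseShift i : ℂ)) = E at *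
  have hy := h1.ne'
  have hz := h2.ne'
  have hden : 4 * (D.η (i (Fin.last p)) : ℂ) ^ 2 * bb + aa * E ^ 2 =
      4 * (D.η (i (Fin.last p)) : ℂ) ^ 2 / (y * z) * (aa + bb * y * z) := by
    rw [hφ, hD, eq_div_of_mul_eq hy ((mul_comm _ _).trans hP)]
    field_simp
    ring
  rw [hden]
  -- If the denominator were zero, both sides would be `0` by the convention for division.
  by_cases h0 : aa + bb * y * z = 0
  · simp [h0]
  have hE0 : E ≠ 0 := right_ne_zero_of_mul_eq_one hE'
  rw [eq_div_of_mul_eq hE0 hE', hD]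
  rw [hD] at h0
  field_simp
  ring

/-! ### The actual solution in homogeneous coordinates -/

open scoped Topology
open Filter

/-- The logarithm `τ_j + α_j - log (2 η_j)` of `e^{τ_j + α_j} / (2 η_j)`. -/
def expo (D : SolitonData N m) (j : Fin N) (x t : ℝ) : ℝ :=
  D.τ j x t + D.α j - Real.log (2 * D.η j)

/-- The first homogeneous coordinate of `e^{τ_j + α_j + iΘ_j} / (2 η_j)`. -/
def aCoord (D : SolitonData N m) (x t : ℝ) (j : Fin N) : ℂ :=
  ((1 + Real.exp (D.expo j x t))⁻¹ : ℝ)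

/-- The second homogeneous coordinate of `e^{τ_j + α_j + iΘ_j} / (2 η_j)`. -/
def bCoord (D : SolitonData N m) (x t : ℝ) (j : Fin N) : ℂ :=
  ((Real.exp (D.expo j x t) / (1 + Real.exp (D.expo j x t)) : ℝ) : ℂ) *
    Complex.exp (Complex.I * (D.Θ j x t : ℂ))

theorem exp_expo (D : SolitonData N m) (j : Fin N) (x t : ℝ) :
    Real.exp (D.expo j x t) = Real.exp (D.τ j x t + D.α j) / (2 * D.η j) := by
  rw [expo, Real.exp_sub, Real.exp_log (mul_pos two_pos (D.η_pos j))]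

theorem norm_aCoord (D : SolitonData N m) (x t : ℝ) (j : Fin N) :
    ‖D.aCoord x t j‖ = (1 + Real.exp (D.expo j x t))⁻¹ := by
  rw [aCoord, Complex.norm_real, Real.norm_of_nonneg (by positivity)]

theorem norm_bCoord (D : SolitonData N m) (x t : ℝ) (j : Fin N) :
    ‖D.bCoord x t j‖ = Real.exp (D.expo j x t) / (1 + Real.exp (D.expo j x t)) := by
  rw [bCoord, norm_mul, Complex.norm_real, Real.norm_of_nonneg (by positivity), mul_comm Complex.I,
    Complex.norm_exp_ofReal_mul_I, mul_one]

theorem norm_aCoord_add_norm_bCoord (D : SolitonData N m) (x t : ℝ) (j : Fin N) :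
    ‖D.aCoord x t j‖ + ‖D.bCoord x t j‖ = 1 := by
  have : 0 < 1 + Real.exp (D.expo j x t) := by positivity
  rw [norm_aCoord, norm_bCoord]
  field_simp

theorem aCoord_ne_zero (D : SolitonData N m) (x t : ℝ) (j : Fin N) : D.aCoord x t j ≠ 0 := by
  rw [← norm_pos_iff, norm_aCoord]; positivity

theorem bCoord_ne_zero (D : SolitonData N m) (x t : ℝ) (j : Fin N) : D.bCoord x t j ≠ 0 := by
  rw [← norm_pos_iff, norm_bCoord]; positivity

/-- `bCoord = aCoord ⬝ e^{expo + iΘ}`. -/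
theorem bCoord_eq (D : SolitonData N m) (x t : ℝ) (j : Fin N) :
    D.bCoord x t j = D.aCoord x t j * (Real.exp (D.expo j x t) : ℂ) *
      Complex.exp (Complex.I * (D.Θ j x t : ℂ)) := by
  rw [bCoord, aCoord]
  push_cast
  ring

theorem U_eq (D : SolitonData N m) (x t : ℝ) :
    D.U x t = Matrix.diagonal (fun j => (Real.exp (D.expo j x t) : ℂ)) +
      Matrix.diagonal (fun j => Complex.exp (-(Complex.I * (D.Θ j x t : ℂ)))) * D.dMat id *
        Matrix.diagonal (fun j => Complex.exp (Complex.I * (D.Θ j x t : ℂ)) *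
          ((Real.exp (D.expo j x t) : ℂ))⁻¹) * (D.cMat id)ᵀ := by
  ext j k
  rw [U, Matrix.of_apply, Matrix.add_apply, Matrix.diagonal_apply, Matrix.mul_apply]
  congr 1
  · simp only [exp_expo]
    push_cast
    rfl
  · refine Finset.sum_congr rfl fun l _ => ?_
    rw [Matrix.mul_diagonal, Matrix.diagonal_mul, lam_eq, exp_expo]
    have hη := D.η_ne_zero l
    have he : Complex.exp (-((D.τ l x t + D.α l : ℝ) : ℂ) +
        Complex.I * ((D.Θ l x t - D.Θ j x t : ℝ) : ℂ)) =
        (Complex.exp ((D.τ l x t + D.α l : ℝ) : ℂ))⁻¹ *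
          Complex.exp (Complex.I * (D.Θ l x t : ℂ)) *
          Complex.exp (-(Complex.I * (D.Θ j x t : ℂ))) := by
      rw [← Complex.exp_neg, ← Complex.exp_add, ← Complex.exp_add]
      congr 1
      push_cast
      ring
    rw [he, Complex.ofReal_div, Complex.ofReal_exp, inv_div]
    simp only [dMat, cMat, Matrix.of_apply, id, Matrix.transpose_apply]
    push_cast
    ring

theorem homMat_coord (hξ : Function.Injective D.ξ) (x t : ℝ) :
    D.homMat (D.aCoord x t) (D.bCoord x t) =
      Matrix.diagonal (fun j => D.aCoord x t j * Complex.exp (Complex.I * (D.Θ j x t : ℂ))) *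
        D.U x t * (D.cInv * (Matrix.diagonal (D.bCoord x t))ᴴ) := by
  have h1 : ∀ A B C E F : Matrix (Fin N) (Fin N) ℂ, A * (B + C * D.dMat id * E * (D.cMat id)ᵀ) *
      (D.cInv * F) = A * B * D.cInv * F + A * C * D.dMat id * (E * F) := by
    intro A B C E F
    rw [Matrix.mul_add, Matrix.add_mul]
    congr 1
    · simp only [Matrix.mul_assoc]
    · simp only [Matrix.mul_assoc]
      rw [← Matrix.mul_assoc (D.cMat id)ᵀ, transpose_mul_cInv hξ, Matrix.one_mul]
  rw [U_eq, h1, homMat, Matrix.diagonal_conjTranspose, Matrix.diagonal_conjTranspose,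
    Matrix.diagonal_mul_diagonal, Matrix.diagonal_mul_diagonal, Matrix.diagonal_mul_diagonal]
  have e1 : D.bCoord x t = fun j => D.aCoord x t j * Complex.exp (Complex.I * (D.Θ j x t : ℂ)) *
      (Real.exp (D.expo j x t) : ℂ) := by
    funext j; rw [bCoord_eq]; ring
  have e2 : D.aCoord x t = fun j => D.aCoord x t j * Complex.exp (Complex.I * (D.Θ j x t : ℂ)) *
      Complex.exp (-(Complex.I * (D.Θ j x t : ℂ))) := by
    funext j; rw [mul_assoc, ← Complex.exp_add]; simp
  have e3 : star (D.aCoord x t) = fun j => Complex.exp (Complex.I * (D.Θ j x t : ℂ)) *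
      ((Real.exp (D.expo j x t) : ℂ))⁻¹ * star (D.bCoord x t) j := by
    funext j
    have h0 : (Real.exp (D.expo j x t) : ℂ) ≠ 0 := by
      exact_mod_cast (Real.exp_pos _).ne'
    have h2 : Complex.exp (Complex.I * (D.Θ j x t : ℂ)) *
        Complex.exp (-(Complex.I * (D.Θ j x t : ℂ))) = 1 := by
      rw [← Complex.exp_add]; simp
    rw [Pi.star_apply, Pi.star_apply, bCoord_eq, star_mul, star_mul]
    simp only [RCLike.star_def, Complex.conj_ofReal, ← Complex.exp_conj, map_mul, Complex.conj_I,
      neg_mul]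
    field_simp
    linear_combination (-conj (D.aCoord x t j)) * h2
  rw [← e1, ← e2, ← e3]

theorem isUnit_det_U (hξ : Function.Injective D.ξ) (x t : ℝ) : IsUnit (D.U x t).det := by
  have h := (homMat_posDef hξ (a := D.aCoord x t) (b := D.bCoord x t)
    fun j => Or.inl (D.aCoord_ne_zero x t j)).det_pos.ne'
  rw [homMat_coord hξ, Matrix.det_mul, Matrix.det_mul] at h
  exact (right_ne_zero_of_mul (left_ne_zero_of_mul h)).isUnit

/-- On the actual orbit every `b_j` is nonzero, so the factor `C B^*` common to both sides of the
equation for `homRow` can be cancelled, leaving a row system with matrix `U`. -/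
theorem q_eq_homSol (hξ : Function.Injective D.ξ) (x t : ℝ) :
    D.q x t = D.homSol (D.aCoord x t) (D.bCoord x t) := by
  have hU := isUnit_det_U hξ x t
  have hab : ∀ j, D.aCoord x t j ≠ 0 ∨ D.bCoord x t j ≠ 0 :=
    fun j => Or.inl (D.aCoord_ne_zero x t j)
  have hM := homRow_vecMul hξ hab
  have hF : IsUnit (D.cInv * (Matrix.diagonal (D.bCoord x t))ᴴ) := by
    refine (cInv_posDef hξ).isUnit.mul ?_
    rw [Matrix.isUnit_iff_isUnit_det, Matrix.diagonal_conjTranspose, Matrix.det_diagonal]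
    exact (Finset.prod_ne_zero_iff.2 fun j _ => star_ne_zero.2 (D.bCoord_ne_zero x t j)).isUnit
  rw [homMat_coord hξ, ← Matrix.vecMul_vecMul _ _ (D.cInv * _)] at hM
  have hM' := (Matrix.vecMul_injective_iff_isUnit.2 hF) hM
  have hr : ∀ k, D.homRow (D.aCoord x t) (D.bCoord x t) k * D.aCoord x t k =
      ∑ j, (D.U x t)⁻¹ j k * Complex.exp (-Complex.I * (D.Θ k x t : ℂ)) := by
    intro k
    have h := congrArg (fun w => (w ᵥ* (D.U x t)⁻¹) k) hM'
    simp only [← Matrix.vecMul_vecMul] at h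
    rw [Matrix.vecMul_vecMul _ (D.U x t), Matrix.mul_nonsing_inv _ hU, Matrix.vecMul_one,
      Matrix.vecMul_diagonal] at h
    simp only [Matrix.vecMul, dotProduct, one_mul] at h
    rw [← Finset.sum_mul, ← h]
    have h2 : Complex.exp (Complex.I * (D.Θ k x t : ℂ)) *
        Complex.exp (-Complex.I * (D.Θ k x t : ℂ)) = 1 := by
      rw [← Complex.exp_add]; simp
    linear_combination (-D.homRow (D.aCoord x t) (D.bCoord x t) k * D.aCoord x t k) * h2
  rw [q, homSol, Finset.sum_comm]
  simp_rw [hr, Finset.sum_smul]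

/-! ### The extended solution at limit points -/

theorem withLast_last (S : Finset (Fin N)) (n : Fin N) : withLast S n (Fin.last _) = n := by
  simp [withLast]

theorem withLast_castSucc (S : Finset (Fin N)) (n : Fin N) (l : Fin S.card) :
    withLast S n l.castSucc = S.orderEmbOfFin rfl l := by
  simp [withLast]

theorem withLast_injective {S : Finset (Fin N)} {n : Fin N} (hn : n ∉ S) :
    Function.Injective (withLast S n) := by
  intro r r' h
  induction r using Fin.lastCases with
  | last =>
    induction r' using Fin.lastCases with
    | last => rfl
    | cast l =>
      rw [withLast_last, withLast_castSucc] at h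
      exact absurd (h ▸ Finset.orderEmbOfFin_mem S rfl l) hn
  | cast l =>
    induction r' using Fin.lastCases with
    | last =>
      rw [withLast_last, withLast_castSucc] at h
      exact absurd (h ▸ Finset.orderEmbOfFin_mem S rfl l) hn
    | cast l' =>
      rw [withLast_castSucc, withLast_castSucc] at h
      rw [(S.orderEmbOfFin rfl).injective h]

theorem mem_range_withLast {S : Finset (Fin N)} {n k : Fin N} (hk : k ∈ S) :
    k ∈ Set.range (withLast S n) := by
  have : k ∈ Set.range (S.orderEmbOfFin rfl) := by simpa using hk
  obtain ⟨l, rfl⟩ := this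
  exact ⟨l.castSucc, withLast_castSucc S n l⟩

theorem soliton_eq_homSoliton (D : SolitonData N m) (S : Finset (Fin N)) (n : Fin N) (x t : ℝ) :
    D.soliton S n x t = D.homSoliton (withLast S n) (D.aCoord x t n) (D.bCoord x t n) := by
  rw [soliton, homSoliton, withLast_last]
  congr 1
  have hη := D.η_pos n
  rw [norm_aCoord, norm_bCoord, bCoord]
  set φ := D.phaseShift (withLast S n)
  have hX : Real.exp (D.τ n x t + D.α n + φ) = 2 * D.η n * Real.exp (D.expo n x t) * Real.exp φ := by
    rw [Real.exp_add, exp_expo]; field_simp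
  rw [sech, Real.cosh_eq, Real.exp_neg, hX, aCoord, Real.exp_neg]
  have hX0 := Real.exp_pos (D.expo n x t)
  have hφ0 := Real.exp_pos φ
  generalize Real.exp (D.expo n x t) = X at *
  generalize Real.exp φ = E at *
  have hc : conj (((X / (1 + X) : ℝ) : ℂ) * Complex.exp (Complex.I * (D.Θ n x t : ℂ))) =
      ((X / (1 + X) : ℝ) : ℂ) * Complex.exp (-Complex.I * (D.Θ n x t : ℂ)) := by
    rw [map_mul, Complex.conj_ofReal, ← Complex.exp_conj, map_mul, Complex.conj_I,
      Complex.conj_ofReal]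
  rw [hc]
  have hr : 2 * D.η n * ((2 * D.η n * X * E + (2 * D.η n * X * E)⁻¹) / 2)⁻¹ =
      8 * D.η n ^ 2 * (1 + X)⁻¹ * (X / (1 + X)) * E⁻¹ /
        (4 * D.η n ^ 2 * (X / (1 + X)) ^ 2 + ((1 + X)⁻¹) ^ 2 * E⁻¹ ^ 2) := by
    have : 0 < 1 + X := by positivity
    have h1 : 4 * D.η n ^ 2 * (X / (1 + X)) ^ 2 + ((1 + X)⁻¹) ^ 2 * E⁻¹ ^ 2 =
      ((2 * D.η n * X * E) ^ 2 + 1) / ((1 + X) * E) ^ 2 := by field_simp; ring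
    have h2 : (2 * D.η n * X * E + (2 * D.η n * X * E)⁻¹) / 2 =
      ((2 * D.η n * X * E) ^ 2 + 1) / (4 * D.η n * X * E) := by field_simp; norm_num
    rw [h1, h2]
    field_simp
    norm_num
  rw [hr]
  push_cast
  ring

theorem homSoliton_eq_zero (D : SolitonData N m) {p : ℕ} (i : Fin (p + 1) → Fin N) {a b : ℂ}
    (h : a * b = 0) : D.homSoliton i a b = 0 := by
  rcases mul_eq_zero.1 h with rfl | rfl <;> simp [homSoliton]

theorem homSol_withLast (hξ : Function.Injective D.ξ) {a b : Fin N → ℂ}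
    (hab : ∀ j, a j ≠ 0 ∨ b j ≠ 0) {S : Finset (Fin N)} {n : Fin N} (hn : n ∉ S)
    (hb : ∀ j ∈ S, b j = 0) (ha : ∀ k, k ∉ S → k ≠ n → a k = 0) :
    D.homSol a b = D.homSoliton (withLast S n) (a n) (b n) := by
  have h := homSol_eq_homSoliton hξ hab (withLast_injective hn)
    (fun l => by
      rw [withLast_castSucc]
      exact hb _ (Finset.orderEmbOfFin_mem S rfl l))
    (fun k hk => ha k (fun h => hk (mem_range_withLast h))
      fun h => hk ⟨Fin.last _, by rw [withLast_last, h]⟩)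
  rwa [withLast_last] at h

theorem homSol_eq_zero (hξ : Function.Injective D.ξ) {a b : Fin N → ℂ}
    (hab : ∀ j, a j ≠ 0 ∨ b j ≠ 0) (h : ∀ j, a j * b j = 0) : D.homSol a b = 0 := by
  by_cases h0 : ∃ n, a n ≠ 0
  · obtain ⟨n, hn⟩ := h0
    -- Any `n` with `a n ≠ 0` serves as the last index, the rest of the support of `a` being `S`;
    -- the one soliton obtained vanishes since `b n = 0`.
    rw [homSol_withLast hξ hab (S := (Finset.univ.filter fun j => a j ≠ 0).erase n) (n := n)
      (by simp), homSoliton_eq_zero _ _ (h n)]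
    · intro j hj
      simp only [Finset.mem_erase, Finset.mem_filter, Finset.mem_univ, true_and] at hj
      exact (mul_eq_zero.1 (h j)).resolve_left hj.2
    · intro k hk hkn
      by_contra hak
      exact hk (by simp [hkn, hak])
  · push Not at h0
    simp [homSol, h0]

theorem homSol_eq_sum (hξ : Function.Injective D.ξ) {a b : Fin N → ℂ}
    (hab : ∀ j, a j ≠ 0 ∨ b j ≠ 0) {S : Fin N → Finset (Fin N)} (hS : ∀ n, n ∉ S n)
    (h1 : ∀ n, ∀ j ∈ S n, a n * b j = 0) (h2 : ∀ n j, j ∉ S n → j ≠ n → a j * b n = 0) :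
    D.homSol a b = ∑ n, D.homSoliton (withLast (S n) n) (a n) (b n) := by
  by_cases h : ∃ n, a n * b n ≠ 0
  · obtain ⟨n, hn⟩ := h
    have hb : ∀ j ∈ S n, b j = 0 := fun j hj =>
      (mul_eq_zero.1 (h1 n j hj)).resolve_left (left_ne_zero_of_mul hn)
    have ha : ∀ j, j ∉ S n → j ≠ n → a j = 0 := fun j hj hjn =>
      (mul_eq_zero.1 (h2 n j hj hjn)).resolve_right (right_ne_zero_of_mul hn)
    rw [homSol_withLast hξ hab (hS n) hb ha]
    symm
    refine Finset.sum_eq_single n (fun j _ hjn => ?_) (by simp)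
    apply homSoliton_eq_zero
    by_cases hj : j ∈ S n
    · rw [hb j hj, mul_zero]
    · rw [ha j hj hjn, zero_mul]
  · push Not at h
    rw [homSol_eq_zero hξ hab h, Finset.sum_eq_zero fun n _ => homSoliton_eq_zero _ _ (h n)]

/-! ### Continuity and passage to the limit -/

theorem continuousAt_homSol (hξ : Function.Injective D.ξ) {a b : Fin N → ℂ}
    (hab : ∀ j, a j ≠ 0 ∨ b j ≠ 0) :
    ContinuousAt (fun f : (Fin N → ℂ) × (Fin N → ℂ) => D.homSol f.1 f.2) (a, b) := by
  have hB : Continuous fun f : (Fin N → ℂ) × (Fin N → ℂ) => (Matrix.diagonal f.2)ᴴ :=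
    (continuous_snd.matrix_diagonal).matrix_conjTranspose
  have hA : Continuous fun f : (Fin N → ℂ) × (Fin N → ℂ) => (Matrix.diagonal f.1)ᴴ :=
    (continuous_fst.matrix_diagonal).matrix_conjTranspose
  have hM : Continuous fun f : (Fin N → ℂ) × (Fin N → ℂ) => D.homMat f.1 f.2 :=
    ((continuous_snd.matrix_diagonal.matrix_mul continuous_const).matrix_mul hB).add
      ((continuous_fst.matrix_diagonal.matrix_mul continuous_const).matrix_mul hA)
  have hrow : ContinuousAt (fun f : (Fin N → ℂ) × (Fin N → ℂ) => D.homRow f.1 f.2) (a, b) := by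
    have e : (fun f : (Fin N → ℂ) × (Fin N → ℂ) => D.homRow f.1 f.2) = fun f =>
        (D.homMat f.1 f.2).det⁻¹ • ((fun _ => 1) ᵥ* (D.cInv * (Matrix.diagonal f.2)ᴴ *
          (D.homMat f.1 f.2).adjugate)) := by
      funext f
      rw [homRow, Matrix.inv_def, Ring.inverse_eq_inv', Matrix.mul_smul, Matrix.vecMul_smul]
    rw [e]
    have hdet : ContinuousAt (fun f : (Fin N → ℂ) × (Fin N → ℂ) => (D.homMat f.1 f.2).det⁻¹)
        (a, b) :=
      hM.matrix_det.continuousAt.inv₀ (homMat_posDef hξ hab).det_pos.ne'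
    have hadj : Continuous fun f : (Fin N → ℂ) × (Fin N → ℂ) =>
        (fun _ => 1) ᵥ* (D.cInv * (Matrix.diagonal f.2)ᴴ * (D.homMat f.1 f.2).adjugate) :=
      continuous_const.matrix_vecMul ((continuous_const.matrix_mul hB).matrix_mul
        hM.matrix_adjugate)
    exact hdet.smul hadj.continuousAt
  have hterm : ∀ j, ContinuousAt (fun f : (Fin N → ℂ) × (Fin N → ℂ) =>
      (D.homRow f.1 f.2 j * f.1 j) • D.u j) (a, b) := fun j =>
    ((continuousAt_pi.1 hrow j).mul
      ((continuous_apply j).comp continuous_fst).continuousAt).smul continuousAt_const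
  have hsum : ContinuousAt (fun f : (Fin N → ℂ) × (Fin N → ℂ) =>
      ∑ j, (D.homRow f.1 f.2 j * f.1 j) • D.u j) (a, b) :=
    tendsto_finsetSum _ fun j _ => hterm j
  exact hsum.const_smul (2 : ℂ)

theorem continuousAt_homSoliton (D : SolitonData N m) {p : ℕ} (i : Fin (p + 1) → Fin N) {a b : ℂ}
    (hab : a ≠ 0 ∨ b ≠ 0) :
    ContinuousAt (fun f : ℂ × ℂ => D.homSoliton i f.1 f.2) (a, b) := by
  have hη := D.η_pos (i (Fin.last p))
  have hE := Real.exp_pos (-D.phaseShift i)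
  have hconj := Complex.continuous_conj
  have hnum : Continuous fun f : ℂ × ℂ => 8 * (D.η (i (Fin.last p)) : ℂ) ^ 2 * f.1 * conj f.2 *
      (Real.exp (-D.phaseShift i) : ℂ) := by fun_prop
  have hden : Continuous fun f : ℂ × ℂ => ((4 * D.η (i (Fin.last p)) ^ 2 * ‖f.2‖ ^ 2 +
      ‖f.1‖ ^ 2 * Real.exp (-D.phaseShift i) ^ 2 : ℝ) : ℂ) := by fun_prop
  have hne : ((4 * D.η (i (Fin.last p)) ^ 2 * ‖b‖ ^ 2 +
      ‖a‖ ^ 2 * Real.exp (-D.phaseShift i) ^ 2 : ℝ) : ℂ) ≠ 0 := by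
    rw [Complex.ofReal_ne_zero]
    rcases hab with h | h
    · have := norm_pos_iff.2 h
      positivity
    · have := norm_pos_iff.2 h
      positivity
  exact (hnum.continuousAt.div hden.continuousAt hne).smul continuousAt_const

theorem tendsto_homSol (hξ : Function.Injective D.ξ) {a b : Fin N → ℂ}
    (hab : ∀ j, a j ≠ 0 ∨ b j ≠ 0) {X : Type*} {F : Filter X} {f g : X → Fin N → ℂ}
    (hf : ∀ j, Tendsto (fun x => f x j) F (𝓝 (a j)))
    (hg : ∀ j, Tendsto (fun x => g x j) F (𝓝 (b j))) :
    Tendsto (fun x => D.homSol (f x) (g x)) F (𝓝 (D.homSol a b)) := by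
  have h := (continuousAt_homSol hξ hab).tendsto.comp
    ((tendsto_pi_nhds.2 hf).prodMk_nhds (tendsto_pi_nhds.2 hg))
  exact h

theorem tendsto_homSoliton (D : SolitonData N m) {p : ℕ} (i : Fin (p + 1) → Fin N) {a b : ℂ}
    (hab : a ≠ 0 ∨ b ≠ 0) {X : Type*} {F : Filter X} {f g : X → ℂ}
    (hf : Tendsto f F (𝓝 a)) (hg : Tendsto g F (𝓝 b)) :
    Tendsto (fun x => D.homSoliton i (f x) (g x)) F (𝓝 (D.homSoliton i a b)) := by
  have h := (continuousAt_homSoliton D i hab).tendsto.comp (hf.prodMk_nhds hg)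
  exact h

/-- Points are pairs `(t, x)`. Along an ultrafilter finer than `l` the bounded coordinates converge,
the hypotheses pass to the limit, and both sides converge to the same value by `homSol_eq_sum`. -/
theorem tendsto_sub_sum_soliton (hξ : Function.Injective D.ξ) {l : Filter (ℝ × ℝ)}
    {S : Fin N → Finset (Fin N)} (hS : ∀ n, n ∉ S n)
    (h1 : ∀ n, ∀ j ∈ S n,
      Tendsto (fun y : ℝ × ℝ => D.aCoord y.2 y.1 n * D.bCoord y.2 y.1 j) l (𝓝 0))
    (h2 : ∀ n j, j ∉ S n → j ≠ n →
      Tendsto (fun y : ℝ × ℝ => D.aCoord y.2 y.1 j * D.bCoord y.2 y.1 n) l (𝓝 0)) :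
    Tendsto (fun y : ℝ × ℝ => D.q y.2 y.1 - ∑ n, D.soliton (S n) n y.2 y.1) l (𝓝 0) := by
  rw [tendsto_iff_ultrafilter]
  intro F hF
  have hnorm : ∀ y : ℝ × ℝ, (D.aCoord y.2 y.1, D.bCoord y.2 y.1) ∈
      Metric.closedBall (0 : (Fin N → ℂ) × (Fin N → ℂ)) 1 := by
    intro y
    rw [mem_closedBall_zero_iff, Prod.norm_def, max_le_iff, pi_norm_le_iff_of_nonneg zero_le_one,
      pi_norm_le_iff_of_nonneg zero_le_one]
    have h := D.norm_aCoord_add_norm_bCoord y.2 y.1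
    exact ⟨fun j => (le_add_of_nonneg_right (norm_nonneg _)).trans_eq (h j),
      fun j => (le_add_of_nonneg_left (norm_nonneg _)).trans_eq (h j)⟩
  have hK : ((F.map fun y : ℝ × ℝ => (D.aCoord y.2 y.1, D.bCoord y.2 y.1) :
      Ultrafilter ((Fin N → ℂ) × (Fin N → ℂ))) : Filter _) ≤
      𝓟 (Metric.closedBall (0 : (Fin N → ℂ) × (Fin N → ℂ)) 1) := by
    rw [Ultrafilter.coe_map]
    exact tendsto_principal.2 (Eventually.of_forall hnorm)
  obtain ⟨ab, -, hlim⟩ := (isCompact_closedBall _ _).ultrafilter_le_nhds _ hK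
  obtain ⟨a, b⟩ := ab
  rw [Ultrafilter.coe_map] at hlim
  have hlim' : Tendsto (fun y : ℝ × ℝ => (D.aCoord y.2 y.1, D.bCoord y.2 y.1)) F (𝓝 (a, b)) := hlim
  have hla : ∀ j, Tendsto (fun y : ℝ × ℝ => D.aCoord y.2 y.1 j) F (𝓝 (a j)) := fun j =>
    tendsto_pi_nhds.1 hlim'.fst_nhds j
  have hlb : ∀ j, Tendsto (fun y : ℝ × ℝ => D.bCoord y.2 y.1 j) F (𝓝 (b j)) := fun j =>
    tendsto_pi_nhds.1 hlim'.snd_nhds j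
  -- The normalization `‖a_j‖ + ‖b_j‖ = 1` survives in the limit, so the limit point lies in the
  -- domain of continuity.
  have hab : ∀ j, a j ≠ 0 ∨ b j ≠ 0 := by
    intro j
    have h := (hla j).norm.add (hlb j).norm
    simp_rw [norm_aCoord_add_norm_bCoord] at h
    have h' := tendsto_nhds_unique h tendsto_const_nhds
    by_contra! hc
    simp [hc.1, hc.2] at h'
  have hab0 : ∀ j k, Tendsto (fun y : ℝ × ℝ => D.aCoord y.2 y.1 j * D.bCoord y.2 y.1 k) l (𝓝 0) →
      a j * b k = 0 := fun j k h =>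
    tendsto_nhds_unique ((hla j).mul (hlb k)) (h.mono_left hF)
  have hsum := homSol_eq_sum hξ hab hS (fun n j hj => hab0 n j (h1 n j hj))
    fun n j hj hjn => hab0 j n (h2 n j hj hjn)
  simp_rw [q_eq_homSol hξ, soliton_eq_homSoliton]
  have hq := tendsto_homSol hξ hab hla hlb
  have hs := fun n => tendsto_homSoliton D (withLast (S n) n) (hab n) (hla n) (hlb n)
  have := hq.sub (tendsto_finsetSum Finset.univ fun n _ => hs n)
  rwa [hsum, sub_self] at this

/-! ### Decay uniform in `x` -/

theorem exp_div_one_add_exp_le {s : ℝ} (hs : 0 ≤ s) (hs1 : s ≤ 1) (y : ℝ) :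
    Real.exp y / (1 + Real.exp y) ≤ Real.exp (s * y) := by
  rw [div_le_iff₀ (by positivity)]
  have hp := Real.exp_pos (s * y)
  rcases le_total 0 y with hy | hy
  · have : 1 ≤ Real.exp (s * y) := Real.one_le_exp (mul_nonneg hs hy)
    nlinarith [Real.exp_pos y]
  · have : Real.exp y ≤ Real.exp (s * y) := Real.exp_le_exp.2 (by nlinarith)
    nlinarith [Real.exp_pos y]

theorem inv_one_add_exp_le {s : ℝ} (hs : 0 ≤ s) (hs1 : s ≤ 1) (y : ℝ) :
    (1 + Real.exp y)⁻¹ ≤ Real.exp (-(s * y)) := by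
  have h := exp_div_one_add_exp_le hs hs1 (-y)
  rw [mul_neg] at h
  refine le_trans (le_of_eq ?_) h
  rw [Real.exp_neg]
  have := Real.exp_pos y
  field_simp
  ring

theorem tendsto_aCoord_mul_bCoord (D : SolitonData N m) {l : Filter ℝ} {j k : Fin N}
    (h : Tendsto (fun t => (D.ξ j - D.ξ k) * t) l atBot) :
    Tendsto (fun y : ℝ × ℝ => D.aCoord y.2 y.1 k * D.bCoord y.2 y.1 j) (l ×ˢ ⊤) (𝓝 0) := by
  have hj := D.η_pos j
  have hk := D.η_pos k
  -- The weights satisfy `s η_j = r η_k`, so `x` cancels from `s * expo j - r * expo k` and only `L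
  -- (ξ_j - ξ_k) t` and a constant remain.
  set s := D.η k / (D.η j + D.η k) with hs
  set r := D.η j / (D.η j + D.η k) with hr
  set K := s * (D.α j - Real.log (2 * D.η j)) - r * (D.α k - Real.log (2 * D.η k))
  set L := 8 * D.η j * D.η k / (D.η j + D.η k) with hL
  have hbound : ∀ y : ℝ × ℝ, ‖D.aCoord y.2 y.1 k * D.bCoord y.2 y.1 j‖ ≤
      Real.exp (L * ((D.ξ j - D.ξ k) * y.1) + K) := by
    intro y
    rw [norm_mul, norm_aCoord, norm_bCoord]
    have e : L * ((D.ξ j - D.ξ k) * y.1) + K =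
        -(r * D.expo k y.2 y.1) + s * D.expo j y.2 y.1 := by
      simp only [K, hL, hs, hr, expo, τ]
      field_simp
      ring
    rw [e, Real.exp_add]
    refine mul_le_mul (inv_one_add_exp_le (by positivity) ?_ _)
      (exp_div_one_add_exp_le (by positivity) ?_ _) (by positivity) (by positivity)
    · rw [hr, div_le_one (by positivity)]; linarith
    · rw [hs, div_le_one (by positivity)]; linarith
  refine squeeze_zero_norm hbound ?_
  have hL0 : 0 < L := by positivity
  exact Real.tendsto_exp_atBot.comp
    (tendsto_atBot_add_const_right _ K ((h.comp tendsto_fst).const_mul_atBot hL0))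

theorem tendstoUniformly_sub_sum_soliton (hξ : Function.Injective D.ξ) {l : Filter ℝ}
    {S : Fin N → Finset (Fin N)} (hS : ∀ n, n ∉ S n)
    (h1 : ∀ n, ∀ j ∈ S n, Tendsto (fun t => (D.ξ j - D.ξ n) * t) l atBot)
    (h2 : ∀ n j, j ∉ S n → j ≠ n → Tendsto (fun t => (D.ξ n - D.ξ j) * t) l atBot) :
    TendstoUniformly (fun (t x : ℝ) => D.q x t - ∑ n, D.soliton (S n) n x t) (fun _ => 0) l := by
  -- Uniformity in `x` is convergence along `l ×ˢ ⊤`, the filter on which the decay was proved.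
  rw [tendstoUniformly_iff_tendsto]
  have h := tendsto_sub_sum_soliton hξ hS
    (fun n j hj => tendsto_aCoord_mul_bCoord D (h1 n j hj))
    fun n j hj hjn => tendsto_aCoord_mul_bCoord D (h2 n j hj hjn)
  refine tendsto_uniformity_iff_dist_tendsto_zero.2 ?_
  have h' := h.norm
  rw [norm_zero] at h'
  simpa only [dist_zero_left] using h'

end SolitonData

end Manakov

end

theorem proposition4p2 {N m : ℕ} (D : Manakov.SolitonData N m) (hξ : StrictAnti D.ξ) :
    -- the solution formula is meaningful everywhere
    (∀ x t : ℝ, IsUnit (D.U x t).det) ∧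
    -- asymptotic forms, uniformly in `x`
    TendstoUniformly (fun (t x : ℝ) => D.q x t - ∑ n, D.soliton (Finset.Iio n) n x t)
      (fun _ => 0) Filter.atBot ∧
    TendstoUniformly (fun (t x : ℝ) => D.q x t - ∑ n, D.soliton (Finset.Ioi n) n x t)
      (fun _ => 0) Filter.atTop ∧
    -- positive definiteness, and reality of `φ_{i_1 … i_p}`
    (∀ (p : ℕ) (i : Fin p → Fin N), Function.Injective i →
      (D.dMat i).PosDef ∧ (D.cMat i).PosDef ∧
      ((Real.exp (-2 * D.phi i) : ℝ) : ℂ) = D.phiSum i) ∧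
    -- determinant formulas for the phase shifts and the polarizations
    (∀ (p : ℕ) (i : Fin (p + 1) → Fin N), Function.Injective i →
      ((Real.exp (-2 * D.phaseShift i) : ℝ) : ℂ) = D.phaseShiftFormula i ∧
      D.polarization i = D.polarizationFormula i) ∧
    -- they depend on the first indices only through the set of these
    (∀ (p : ℕ) (i i' : Fin (p + 1) → Fin N), Function.Injective i → Function.Injective i' →
      i (Fin.last p) = i' (Fin.last p) → Set.range i = Set.range i' →
      D.phaseShift i = D.phaseShift i' ∧ D.polarization i = D.polarization i') ∧
    -- the case of no first indices
    (∀ n : Fin N, D.phaseShift (fun _ : Fin 1 => n) = 0 ∧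
      D.polarization (fun _ : Fin 1 => n) = D.u n) := by
  have hinj := hξ.injective
  refine ⟨Manakov.SolitonData.isUnit_det_U hinj, ?_, ?_, fun p i hi =>
    ⟨Manakov.SolitonData.dMat_posDef hinj hi, Manakov.SolitonData.cMat_posDef hinj hi,
      Manakov.SolitonData.exp_neg_two_mul_phi hinj hi⟩, fun p i hi =>
    ⟨Manakov.SolitonData.exp_neg_two_mul_phaseShift hinj hi,
      Manakov.SolitonData.polarization_eq_polarizationFormula hinj hi⟩, fun p i i' hi hi' hl hr =>
    Manakov.SolitonData.phaseShift_eq_and_polarization_eq_of_range_eq hinj hi hi' hl hr, fun n =>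
    ⟨Manakov.SolitonData.phaseShift_const hinj n, Manakov.SolitonData.polarization_const hinj n⟩⟩
  -- For `j < n` one has `ξ_j > ξ_n`, so `(ξ_j - ξ_n) t → -∞` as `t → -∞`; as `t → +∞` the order,
  -- and with it `S n`, is reversed.
  · refine Manakov.SolitonData.tendstoUniformly_sub_sum_soliton hinj (by simp) ?_ ?_
    · intro n j hj
      exact Filter.tendsto_id.const_mul_atBot (sub_pos.2 (hξ (Finset.mem_Iio.1 hj)))
    · intro n j hj hjn
      refine Filter.tendsto_id.const_mul_atBot (sub_pos.2 (hξ ?_))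
      exact lt_of_le_of_ne (not_lt.1 fun h => hj (Finset.mem_Iio.2 h)) hjn.symm
  · refine Manakov.SolitonData.tendstoUniformly_sub_sum_soliton hinj (by simp) ?_ ?_
    · intro n j hj
      exact Filter.tendsto_id.const_mul_atTop_of_neg (sub_neg.2 (hξ (Finset.mem_Ioi.1 hj)))
    · intro n j hj hjn
      refine Filter.tendsto_id.const_mul_atTop_of_neg (sub_neg.2 (hξ ?_))
      exact lt_of_le_of_ne (not_lt.1 fun h => hj (Finset.mem_Ioi.2 h)) hjn
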